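/- **Setting.** Let $d\ge 2$, let $\mathcal X\subseteq\mathbb R^d$ be closed, star-convex about the origin and contained in the Euclidean unit ball, let $\theta,a\in\mathbb R^d$ with $\|\theta\|\le S_\theta$, $\|a\|\le S_a$ ($S_\theta,S_a>0$), put $S=\max(S_a,S_\theta)$, and let $0<b\le S_a$, $\nu=b/S_a$. In each round $t=1,\dots,T$ the learner plays $x_t\in\mathcal X$ and observes $y_t=\theta^\top x_t+\epsilon_t$ and $z_t=a^\top x_t+\eta_t$. For every $t\le T$, $\mathbb E[\epsilon_t\mid x_1,\epsilon_1,\dots,\epsilon_{t-1},x_t]=0$ and $\mathbb E[e^{s\epsilon_t}\mid x_1,\epsilon_1,\dots,\epsilon_{t-1},x_t]\le e^{s^2\rho^2/2}$ for all $s\in\mathbb R$ (with $\rho\ge 0$), and the same holds with $\eta$ in place of $\epsilon$. Let $\mathcal Y=\{x\in\mathcal X: a^\top x\le b\}$, let $x_*$ maximize $\theta^\top x$ over $\mathcal Y$, assume $\theta^\top x_*>0$, let $R_T=\sum_{t=1}^T\theta^\top(x_*-x_t)$ be the regret, and let $$\Delta=\inf\{\theta^\top(x_*-x): x\in\mathcal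 Y,\ x\ne\alpha x_*\ \text{for all }\alpha>0\}.$$ Let $\lambda\ge1$, $\delta\in(0,1)$, and $$\beta_s=\rho\sqrt{d\log\frac{1+(s-1)/\lambda}{\delta/2}}+\sqrt\lambda\,S,\qquad \tilde\beta_s=\rho\sqrt{\log\frac{1+(s-1)/\lambda}{\delta/2}}+\sqrt\lambda\,S,\qquad \bar B=\frac{32S^2\beta_T^2d}{b^2\Delta^2}\log\Bigl(1+\frac{T}{\lambda d}\Bigr).$$ **ROFUL.** In round $t$ put $V_t=\lambda I+\sum_{k<t}x_kx_k^\top$, $\hat\theta_t=V_t^{-1}\sum_{k<t}y_kx_k$, $\hat a_t=V_t^{-1}\sum_{k<t}z_kx_k$, $\|x\|_{V_t^{-1}}=\sqrt{x^\top V_t^{-1}x}$, $\mathcal Y^p_t=\{x\in\mathcal X:\hat a_t^\top x+\beta_t\|x\|_{V_t^{-1}}\le b\}$ and $\mathcal Y^o_t=\{x\in\mathcal X:\hat a_t^\top x-\beta_t\|x\|_{V_t^{-1}}\le b\}$; choose any $\tilde x_t\in\operatorname{argmax}_{x\in\mathcal Y^o_t}(\hat\theta_t^\top x+\beta_t\|x\|_{V_t^{-1}})$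 and play $x_t=\max(\min(\nu/\|\tilde x_t\|,1),\mu_t)\,\tilde x_t$ with $\mu_t=\max\{\mu\in[0,1]:\mu\tilde x_t\in\mathcal Y_t^p\}$. **PD-ROFUL** ($\Delta>0$ known). Play ROFUL until some direction $u_*$ (a unit vector $x_t/\|x_t\|$, $x_t\neq0$) has been played more than $\bar B$ times. Let $\tau$ be the next round. In the rounds $t=\tau,\dots,T$ play $x_t=\xi_tu_*$, where $\xi_t$ is the largest $\xi$ with $\xi u_*\in\mathcal X$ and $\hat\phi_t\xi+\tilde\beta_{t-\tau+1}|\xi|/\sqrt{v_t}\le b$, with $v_t=\lambda+\sum_{s=\tau}^{t-1}\xi_s^2$ and $\hat\phi_t=v_t^{-1}\sum_{s=\tau}^{t-1}\xi_sz_s$. **Claim.** If $\Delta>0$, then with probability at least $1-2\delta$ the regret of PD-ROFUL satisfies $$R_T\le\frac{8S}{b}\,\beta_{2\bar B}\sqrt{d\bar B\log\Bigl(1+\frac{2\bar B}{\lambda d}\Bigr)}+\frac{4S}{b}\,\tilde\beta_T\sqrt{2T\log\Bigl(1+\frac{T}{\lambda d}\Bigr)} .$$ Moreover the regret is $\tilde{\mathcal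 O}\bigl(\frac{d^2}{b^2\Delta}+\frac{\sqrt T}{b}\bigr)$: there are $C$ and $n$ that depend only on $\rho,\lambda,\delta,S_a,S_\theta$ such that for every such problem (all $d\ge2$, $\mathcal X,\theta,a,b$, noise, and all $T\ge 1$) with $\Delta>0$, with probability at least $1-2\delta$, $R_T\le C(1+\log T)^n\bigl(\frac{d^2}{b^2\Delta}+\frac{\sqrt T}{b}\bigr)$. -/

import Mathlib

open MeasureTheory Matrix

noncomputable section

namespace SafeBandit

/-- The action space `ℝᵈ` with the Euclidean norm. -/
abbrev Vec (d : ℕ) : Type := EuclideanSpace ℝ (Fin d)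

/-! ### The problem -/

/-- A safe linear bandit problem: action set, reward vector, constraint vector, constraint limit. -/
structure Problem (d : ℕ) where
  /-- the action set -/
  X : Set (Vec d)
  /-- the reward vector (unknown to the learner) -/
  θ : Vec d
  /-- the constraint vector (unknown to the learner) -/
  a : Vec d
  /-- the constraint limit -/
  b : ℝ

/-- The numerical parameters: subgaussian constant `ρ`, regularization `lam`, confidence `δ`, and
the norm bounds `Sa`, `Sθ` on the constraint and the reward vector. -/
structure Params where
  ρ : ℝ
  lam : ℝ
  δ : ℝ
  Sa : ℝ
  Sθ : ℝ

/-- `S = max (Sa, Sθ)`. -/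
def Params.S (p : Params) : ℝ := max p.Sa p.Sθ

/-- The ranges of the parameters. -/
structure Params.Valid (p : Params) : Prop where
  ρ_nonneg : 0 ≤ p.ρ
  one_le_lam : 1 ≤ p.lam
  δ_pos : 0 < p.δ
  δ_lt_one : p.δ < 1
  Sa_pos : 0 < p.Sa
  Sθ_pos : 0 < p.Sθ

variable {d : ℕ}

/-- The feasible set `{x ∈ X : aᵀ x ≤ b}`. -/
def Problem.feasible (P : Problem d) : Set (Vec d) :=
  {x | x ∈ P.X ∧ inner ℝ P.a x ≤ P.b}

/-- `xs` is an optimal constraint-satisfying action, `xs ∈ argmax_{x feasible} θᵀ x`. -/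
def Problem.IsOptimal (P : Problem d) (xs : Vec d) : Prop :=
  xs ∈ P.feasible ∧ ∀ x ∈ P.feasible, inner ℝ P.θ x ≤ inner ℝ P.θ xs

/-- The reward gap: the infimum of `θᵀ (xs - x)` over the feasible actions `x` that are not a
positive multiple of `xs`. -/
def Problem.gap (P : Problem d) (xs : Vec d) : ℝ :=
  sInf {r | ∃ x ∈ P.feasible, (∀ α : ℝ, 0 < α → x ≠ α • xs) ∧ r = inner ℝ P.θ (xs - x)}

/-- The standing assumptions on the problem: the action set is closed, star-convex (about the
origin) and contained in the unit ball, the optimal action has positive reward, the norm bounds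
hold, the limit is positive and `b / Sa ≤ 1`. -/
structure Problem.Admissible (P : Problem d) (p : Params) (xs : Vec d) : Prop where
  closed : IsClosed P.X
  star : StarConvex ℝ 0 P.X
  norm_le_one : ∀ x ∈ P.X, ‖x‖ ≤ 1
  b_pos : 0 < P.b
  norm_a_le : ‖P.a‖ ≤ p.Sa
  norm_θ_le : ‖P.θ‖ ≤ p.Sθ
  ν_le_one : P.b / p.Sa ≤ 1
  optimal : P.IsOptimal xs
  reward_pos : 0 < inner ℝ P.θ xs

/-! ### The noise -/

/-- The information `x₁, ε₁, x₂, ε₂, …, ε_{t-1}, x_t`. -/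
@[reducible] def history {Ω : Type*} (x : ℕ → Ω → Vec d) (ε : ℕ → Ω → ℝ) (t : ℕ) : MeasurableSpace Ω :=
  (⨆ k ∈ Finset.Icc 1 t, MeasurableSpace.comap (x k) inferInstance) ⊔
    (⨆ k ∈ Finset.Ico 1 t, MeasurableSpace.comap (ε k) inferInstance)

/-- In the rounds `1, …, T` the noise `ε` is centered and `ρ`-subgaussian conditionally on the
history (including the current action). -/
structure IsSubgaussianNoise {Ω : Type*} [MeasurableSpace Ω] (μ : Measure Ω) (T : ℕ) (ρ : ℝ)
    (x : ℕ → Ω → Vec d) (ε : ℕ → Ω → ℝ) : Prop where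
  measurable : ∀ t, Measurable (ε t)
  integrable : ∀ t ∈ Finset.Icc 1 T, Integrable (ε t) μ
  centered : ∀ t ∈ Finset.Icc 1 T, μ[ε t | history x ε t] =ᵐ[μ] 0
  integrable_exp : ∀ t ∈ Finset.Icc 1 T, ∀ s : ℝ, Integrable (fun ω => Real.exp (s * ε t ω)) μ
  subgaussian : ∀ t ∈ Finset.Icc 1 T, ∀ s : ℝ,
    ∀ᵐ ω ∂μ, (μ[fun ω' => Real.exp (s * ε t ω') | history x ε t]) ω
      ≤ Real.exp (s ^ 2 * ρ ^ 2 / 2)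

/-! ### ROFUL

In this part `x`, `y`, `z` are one realization of the actions, the reward observations and the
constraint observations; rounds are numbered from `1`. -/

/-- The radius `ρ √(m log ((1 + (s - 1)/lam) / (δ/2))) + √lam S` in dimension `m` at time `s`. -/
def radius (p : Params) (m : ℕ) (s : ℝ) : ℝ :=
  p.ρ * √(m * Real.log ((1 + (s - 1) / p.lam) / (p.δ / 2))) + √p.lam * p.S

/-- `V_t = ∑_{k < t} x_k x_kᵀ + lam I`. -/
def gram (lam : ℝ) (x : ℕ → Vec d) (t : ℕ) : Matrix (Fin d) (Fin d) ℝ :=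
  ∑ k ∈ Finset.Ico 1 t, vecMulVec (x k).ofLp (x k).ofLp + lam • (1 : Matrix (Fin d) (Fin d) ℝ)

/-- The regularized least-squares estimator `V_t⁻¹ ∑_{k < t} w_k x_k` from observations `w`. -/
def estimator (lam : ℝ) (x : ℕ → Vec d) (w : ℕ → ℝ) (t : ℕ) : Vec d :=
  WithLp.toLp 2 ((gram lam x t)⁻¹ *ᵥ (∑ k ∈ Finset.Ico 1 t, w k • x k).ofLp)

/-- The weighted norm `‖v‖_M = √(vᵀ M v)`. -/
def weightedNorm (M : Matrix (Fin d) (Fin d) ℝ) (v : Vec d) : ℝ :=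
  √(v.ofLp ⬝ᵥ (M *ᵥ v.ofLp))

/-- The width `β_t ‖v‖_{V_t⁻¹}`. -/
def width (p : Params) (x : ℕ → Vec d) (t : ℕ) (v : Vec d) : ℝ :=
  radius p d t * weightedNorm (gram p.lam x t)⁻¹ v

/-- The pessimistic action set. -/
def pessimistic (P : Problem d) (p : Params) (x : ℕ → Vec d) (z : ℕ → ℝ) (t : ℕ) : Set (Vec d) :=
  {v | v ∈ P.X ∧ inner ℝ (estimator p.lam x z t) v + width p x t v ≤ P.b}

/-- The optimistic action set. -/
def optimistic (P : Problem d) (p : Params) (x : ℕ → Vec d) (z : ℕ → ℝ) (t : ℕ) : Set (Vec d) :=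
  {v | v ∈ P.X ∧ inner ℝ (estimator p.lam x z t) v - width p x t v ≤ P.b}

/-- The upper confidence bound on the reward of `v`. -/
def ucb (p : Params) (x : ℕ → Vec d) (y : ℕ → ℝ) (t : ℕ) (v : Vec d) : ℝ :=
  inner ℝ (estimator p.lam x y t) v + width p x t v

/-- The action `x t` is one that ROFUL may choose in round `t`: a maximizer `v` of the upper
confidence bound over the optimistic set, scaled by the larger of `min (ν / ‖v‖, 1)`, where
`ν = b / Sa`, and the largest `m ∈ [0, 1]` for which `m v` is in the pessimistic set. -/
def IsROFULStep (P : Problem d) (p : Params) (x : ℕ → Vec d) (y z : ℕ → ℝ) (t : ℕ) : Prop :=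
  ∃ v ∈ optimistic P p x z t, (∀ w ∈ optimistic P p x z t, ucb p x y t w ≤ ucb p x y t v) ∧
    ∃ m : ℝ, IsGreatest {m : ℝ | m ∈ Set.Icc 0 1 ∧ m • v ∈ pessimistic P p x z t} m ∧
      x t = max (min (P.b / p.Sa / ‖v‖) 1) m • v

/-! ### PD-ROFUL -/

/-- The threshold `B̄ = 32 S² β_T² d / (b² Δ²) * log (1 + T / (lam d))`. -/
def threshold (P : Problem d) (p : Params) (xs : Vec d) (T : ℕ) : ℝ :=
  32 * p.S ^ 2 * radius p d T ^ 2 * d / (P.b ^ 2 * P.gap xs ^ 2) *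
    Real.log (1 + T / (p.lam * d))

open Classical in
/-- How often the direction `u` (a unit vector) was played before round `t`. The action `0` has no
direction and is never counted. -/
def playCount (x : ℕ → Vec d) (u : Vec d) (t : ℕ) : ℕ :=
  ((Finset.Ico 1 t).filter (fun k => ‖x k‖⁻¹ • x k = u)).card

/-- Before round `t`, some direction was played more than `B` times. -/
def Identified (B : ℝ) (x : ℕ → Vec d) (t : ℕ) : Prop :=
  ∃ u : Vec d, ‖u‖ = 1 ∧ B < playCount x u t

/-- The second phase starts in round `τ`, with `u` as the direction played most often so far. -/
def IsSwitch (B : ℝ) (x : ℕ → Vec d) (τ : ℕ) (u : Vec d) : Prop :=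
  IsLeast {t | Identified B x t} τ ∧ ‖u‖ = 1 ∧
    ∀ v : Vec d, ‖v‖ = 1 → playCount x v τ ≤ playCount x u τ

/-- `lam + ∑_{τ ≤ s < t} ξ_s²`, where `ξ_s = uᵀ x_s` (so `x_s = ξ_s u` in the second phase). -/
def gram₁ (lam : ℝ) (x : ℕ → Vec d) (τ : ℕ) (u : Vec d) (t : ℕ) : ℝ :=
  lam + ∑ s ∈ Finset.Ico τ t, inner ℝ u (x s) ^ 2

/-- The one-dimensional estimator of `aᵀ u` from the observations of the second phase. -/
def estimator₁ (lam : ℝ) (x : ℕ → Vec d) (z : ℕ → ℝ) (τ : ℕ) (u : Vec d) (t : ℕ) : ℝ :=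
  1 / gram₁ lam x τ u t * ∑ s ∈ Finset.Ico τ t, inner ℝ u (x s) * z s

/-- The pessimistic set of scalars in round `t` of the second phase. The radius is the
one-dimensional one, restarted: in round `t` it is taken at time `t - τ + 1`. -/
def pessimistic₁ (P : Problem d) (p : Params) (x : ℕ → Vec d) (z : ℕ → ℝ) (τ : ℕ) (u : Vec d)
    (t : ℕ) : Set ℝ :=
  {ξ | ξ • u ∈ P.X ∧ estimator₁ p.lam x z τ u t * ξ +
    radius p 1 ((t : ℝ) - τ + 1) * (|ξ| / √(gram₁ p.lam x τ u t)) ≤ P.b}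

/-- The realization `x`, `y`, `z` is one that PD-ROFUL may produce in the rounds `1, …, T`: as long
as no direction has been played more than `B` times the actions are chosen by ROFUL, and from the
switch `(τ, u)` on the action is `ξ u` with the largest `ξ` in the pessimistic set of scalars. -/
def IsPDROFULPath (P : Problem d) (p : Params) (B : ℝ) (T : ℕ) (x : ℕ → Vec d)
    (y z : ℕ → ℝ) : Prop :=
  ∀ t ∈ Finset.Icc 1 T,
    (¬ Identified B x t → IsROFULStep P p x y z t) ∧
    ∀ τ u, IsSwitch B x τ u → τ ≤ t →
      ∃ ξ, IsGreatest (pessimistic₁ P p x z τ u t) ξ ∧ x t = ξ • u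

/-- `x` is the sequence of actions of PD-ROFUL with threshold `threshold P p xs T` (it knows the
reward gap) on the problem `P` with horizon `T`, where `θᵀ x_t + ε_t` and `aᵀ x_t + η_t` are
observed, and both noises satisfy the noise assumption. -/
structure IsPDROFULRun {Ω : Type*} [MeasurableSpace Ω] (μ : Measure Ω) (P : Problem d) (p : Params)
    (xs : Vec d) (T : ℕ) (x : ℕ → Ω → Vec d) (ε η : ℕ → Ω → ℝ) : Prop where
  measurable : ∀ t, Measurable (x t)
  reward_noise : IsSubgaussianNoise μ T p.ρ x ε
  constraint_noise : IsSubgaussianNoise μ T p.ρ x η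
  path : ∀ ω, IsPDROFULPath P p (threshold P p xs T) T (fun t => x t ω)
    (fun t => inner ℝ P.θ (x t ω) + ε t ω) (fun t => inner ℝ P.a (x t ω) + η t ω)

/-! ### Regret and the bound -/

/-- The constrained pseudo-regret `∑_{t ≤ T} θᵀ (xs - x_t)` of the actions `x`. -/
def regret (P : Problem d) (xs : Vec d) (T : ℕ) (x : ℕ → Vec d) : ℝ :=
  ∑ t ∈ Finset.Icc 1 T, inner ℝ P.θ (xs - x t)

/-- The bound `8 S / b * β_{2B̄} √(d B̄ log (1 + 2B̄ / (lam d)))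
+ 4 S / b * β̃_T √(2 T log (1 + T / (lam d)))`. -/
def regretBound (P : Problem d) (p : Params) (xs : Vec d) (T : ℕ) : ℝ :=
  8 * p.S / P.b * radius p d (2 * threshold P p xs T) *
      √(d * threshold P p xs T * Real.log (1 + 2 * threshold P p xs T / (p.lam * d))) +
    4 * p.S / P.b * radius p 1 T * √(2 * T * Real.log (1 + T / (p.lam * d)))

end SafeBandit

end

open SafeBandit

noncomputable section

/-! The regret is controlled on one event, `GoodPath`, on which three self-normalized noise bounds
hold; everything else is deterministic.

Noise. If `S_t = ∑ e_k x_k` and `V_t` is the Gram matrix, the classical mixture `√(lam ^ d / det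
V_t) * exp (‖S_t‖² / 2)`, with the norm of `V_t⁻¹`, is a supermartingale. It is treated here as a
product of one-round factors `mixFactor` (`mixProd_eq`), each of conditional mean at most 1
(`lintegral_mixFactor_le_one`), so only scalar Gaussian integrals occur. Stopping the product and
applying Markov's inequality gives `measure_selfNormalized_le`.

First phase. Optimism and the scaling of the action bound the regret of a ROFUL round by `4 S / b`
times its width (`IsROFULStep.regret_le`), and the actions are feasible. A round that misses the
direction of `xs` costs at least the gap, so its squared width is bounded below; the squared widths
have a logarithmic sum. Hence there are at most `3/4` of the threshold such rounds
(`GoodPath.card_wrongRounds_le`). So the direction identified is that of `xs`, and the first phase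
has at most `7/4` of the threshold plus one rounds.

Second phase. On the line through `xs` only one unknown scalar matters, and a largest pessimistic
multiple has regret proportional to its one-dimensional width (`regret_of_isGreatest_pessimistic₁`).
The switching time and the identified direction are random, but no union bound is needed:
`directionScalar` is a predictable sequence attached to the fixed direction of `xs`, and on a good
path it coincides with the second-phase scalars and vanishes before (`sum_directionScalar`).

Constants. The first phase uses `17/10` of the `2` units of `firstBound` contained in the bound. The
remaining `3/10` pay for the second phase when `T ≤ lam d²`: there the one-dimensional potential
produces `log (1 + T / lam)`, while the claim has `log (1 + T / (lam d))` (`secondBound_le`). The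
asymptotic bound is derived separately from the same decomposition. -/

namespace SafeBandit
open ProbabilityTheory
open scoped ENNReal NNReal

/-! ### Scalar Gaussian mixtures of exponential moments -/

/-- The factor by which the mixture of exponential supermartingales grows in one round. -/
def mixFactor (a c e : ℝ) : ℝ :=
  √(1 - a) * Real.exp (a * e ^ 2 / 2 + c * e - c ^ 2 / (2 * (1 - a)))

lemma mixFactor_nonneg (a c e : ℝ) : 0 ≤ mixFactor a c e := by
  unfold mixFactor; positivity

lemma mixFactor_zero (e : ℝ) : mixFactor 0 0 e = 1 := by simp [mixFactor]

lemma measurable_mixFactor : Measurable (fun q : ℝ × ℝ × ℝ => mixFactor q.1 q.2.1 q.2.2) := by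
  unfold mixFactor
  fun_prop

lemma gaussianPDFReal_mul_exp (k g : ℝ) :
    gaussianPDFReal 0 1 g * Real.exp (k * g) = Real.exp (k ^ 2 / 2) * gaussianPDFReal k 1 g := by
  simp only [gaussianPDFReal]
  rw [mul_assoc, ← Real.exp_add, mul_left_comm, ← Real.exp_add]
  congr 2
  push_cast
  ring

lemma lintegral_gaussianPDFReal_mul_exp (k : ℝ) :
    ∫⁻ g, ENNReal.ofReal (gaussianPDFReal 0 1 g * Real.exp (k * g)) =
      ENNReal.ofReal (Real.exp (k ^ 2 / 2)) := by
  simp_rw [gaussianPDFReal_mul_exp, ENNReal.ofReal_mul (Real.exp_nonneg _)]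
  rw [lintegral_const_mul _ (measurable_gaussianPDFReal _ _).ennreal_ofReal,
    lintegral_gaussianPDFReal_eq_one _ one_ne_zero, mul_one]

lemma gaussianPDFReal_mul_exp_sq {a : ℝ} (ha : 0 ≤ a) (ha1 : a < 1) (c g : ℝ) :
    gaussianPDFReal 0 1 g * Real.exp ((√a * g + c) ^ 2 / 2) =
      (√(1 - a))⁻¹ * Real.exp (c ^ 2 / (2 * (1 - a))) *
        gaussianPDFReal (√a * c / (1 - a)) (Real.toNNReal (1 / (1 - a))) g := by
  have h1 : 0 < 1 - a := by linarith
  have h2 : ((Real.toNNReal (1 / (1 - a)) : ℝ≥0) : ℝ) = 1 / (1 - a) :=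
    Real.coe_toNNReal _ (by positivity)
  have h3 : √a ^ 2 = a := Real.sq_sqrt ha
  simp only [gaussianPDFReal, h2]
  have h4 : √(2 * Real.pi * (1 / (1 - a))) = √(2 * Real.pi) * (√(1 - a))⁻¹ := by
    rw [Real.sqrt_mul (by positivity), one_div, Real.sqrt_inv]
  rw [h4, mul_assoc, ← Real.exp_add]
  have h5 : -(g - 0) ^ 2 / (2 * ((1 : ℝ≥0) : ℝ)) + (√a * g + c) ^ 2 / 2 =
      c ^ 2 / (2 * (1 - a)) + -(g - √a * c / (1 - a)) ^ 2 / (2 * (1 / (1 - a))) := by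
    push_cast
    have h6 : (√a * g + c) ^ 2 = a * g ^ 2 + 2 * √a * g * c + c ^ 2 := by rw [add_sq, mul_pow, h3]; ring
    have h7 : (g - √a * c / (1 - a)) ^ 2 =
        g ^ 2 - 2 * √a * c * g / (1 - a) + a * c ^ 2 / (1 - a) ^ 2 := by
      rw [sub_sq, div_pow, mul_pow, h3]; ring
    rw [h6, h7]
    field_simp
    ring
  rw [h5, Real.exp_add]
  have h8 : √(1 - a) ≠ 0 := (Real.sqrt_pos.2 h1).ne'
  push_cast
  rw [mul_one]
  field_simp

lemma lintegral_gaussianPDFReal_mul_exp_sq {a : ℝ} (ha : 0 ≤ a) (ha1 : a < 1) (c : ℝ) :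
    ∫⁻ g, ENNReal.ofReal (gaussianPDFReal 0 1 g * Real.exp ((√a * g + c) ^ 2 / 2)) =
      ENNReal.ofReal ((√(1 - a))⁻¹ * Real.exp (c ^ 2 / (2 * (1 - a)))) := by
  simp_rw [gaussianPDFReal_mul_exp_sq ha ha1]
  have h0 : Real.toNNReal (1 / (1 - a)) ≠ 0 := by
    have : 0 < 1 / (1 - a) := by have : 0 < 1 - a := by linarith
                                 positivity
    simpa using this
  have h1 : 0 ≤ (√(1 - a))⁻¹ * Real.exp (c ^ 2 / (2 * (1 - a))) := by positivity
  simp_rw [ENNReal.ofReal_mul h1]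
  rw [lintegral_const_mul _ (measurable_gaussianPDFReal _ _).ennreal_ofReal,
    lintegral_gaussianPDFReal_eq_one _ h0, mul_one]

/-- Linearize the square by a standard Gaussian `g`: `exp (a e² / 2)` is the mean of `exp (√a g e)`.
After exchanging the integrals, subgaussianity applies at the parameter `(√a g + c) / ρ`, and the
remaining Gaussian integral is exactly the reciprocal of the normalization in `mixFactor`. For
standard Gaussian noise there is equality. -/
lemma lintegral_mixFactor_le_one {κ : Measure ℝ} [SFinite κ] {ρ : ℝ} (hρ : 0 < ρ)
    (hκ : ∀ s : ℝ, ∫⁻ y, ENNReal.ofReal (Real.exp (s * y)) ∂κ ≤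
      ENNReal.ofReal (Real.exp (s ^ 2 * ρ ^ 2 / 2)))
    {a : ℝ} (ha : 0 ≤ a) (ha1 : a < 1) (c : ℝ) :
    ∫⁻ y, ENNReal.ofReal (mixFactor a c (y / ρ)) ∂κ ≤ 1 := by
  have h1 : 0 < 1 - a := by linarith
  have hs : 0 < √(1 - a) := Real.sqrt_pos.2 h1
  set k : ℝ := √(1 - a) * Real.exp (-(c ^ 2 / (2 * (1 - a)))) with hk
  have hk0 : 0 ≤ k := by positivity
  have key : ∀ y, ENNReal.ofReal (mixFactor a c (y / ρ)) = ENNReal.ofReal k *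
      ∫⁻ g, ENNReal.ofReal (gaussianPDFReal 0 1 g * Real.exp ((√a * g + c) / ρ * y)) := by
    intro y
    have e1 : ∀ g, gaussianPDFReal 0 1 g * Real.exp ((√a * g + c) / ρ * y) =
        Real.exp (c * (y / ρ)) * (gaussianPDFReal 0 1 g * Real.exp ((√a * (y / ρ)) * g)) := by
      intro g
      rw [mul_left_comm, ← Real.exp_add]
      congr 2
      ring
    simp_rw [e1, ENNReal.ofReal_mul (Real.exp_nonneg (c * (y / ρ)))]
    rw [lintegral_const_mul _ (by
      exact ((measurable_gaussianPDFReal _ _).mul (by fun_prop)).ennreal_ofReal),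
      lintegral_gaussianPDFReal_mul_exp, ← ENNReal.ofReal_mul (by positivity),
      ← ENNReal.ofReal_mul hk0, mixFactor, hk, mul_assoc, ← Real.exp_add, ← Real.exp_add,
      mul_pow, Real.sq_sqrt ha]
    congr 3
    ring
  simp_rw [key]
  have hm : Measurable (Function.uncurry fun (y g : ℝ) =>
      ENNReal.ofReal (gaussianPDFReal 0 1 g * Real.exp ((√a * g + c) / ρ * y))) := by
    refine Measurable.ennreal_ofReal (Measurable.mul ?_ (by fun_prop))
    exact (measurable_gaussianPDFReal 0 1).comp measurable_snd
  rw [lintegral_const_mul _ (Measurable.lintegral_prod_right hm),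
    lintegral_lintegral_swap hm.aemeasurable]
  calc _ ≤ ENNReal.ofReal k * ∫⁻ g, ENNReal.ofReal (gaussianPDFReal 0 1 g *
        Real.exp ((√a * g + c) ^ 2 / 2)) := by
        gcongr with g
        simp_rw [ENNReal.ofReal_mul (gaussianPDFReal_nonneg 0 1 g)]
        rw [lintegral_const_mul _ (by fun_prop)]
        gcongr
        refine (hκ _).trans (le_of_eq ?_)
        congr 2
        field_simp
    _ = 1 := by
        rw [lintegral_gaussianPDFReal_mul_exp_sq ha ha1, ← ENNReal.ofReal_mul hk0, hk]
        rw [show √(1 - a) * Real.exp (-(c ^ 2 / (2 * (1 - a)))) *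
          ((√(1 - a))⁻¹ * Real.exp (c ^ 2 / (2 * (1 - a)))) = (√(1 - a) * (√(1 - a))⁻¹) *
          (Real.exp (-(c ^ 2 / (2 * (1 - a)))) * Real.exp (c ^ 2 / (2 * (1 - a)))) by ring,
          ← Real.exp_add, mul_inv_cancel₀ hs.ne']
        simp

/-- A random variable that is subgaussian conditionally on `X` has almost surely subgaussian
conditional laws given `X`. -/
lemma ae_condDistrib_lintegral_exp_le {Ω β : Type*} [MeasurableSpace Ω] [mβ : MeasurableSpace β]
    {μ : Measure Ω} [IsProbabilityMeasure μ] {X : Ω → β} (hX : Measurable X) {Y : Ω → ℝ}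
    (hY : Measurable Y) {ρ : ℝ}
    (hint : ∀ s : ℝ, Integrable (fun ω => Real.exp (s * Y ω)) μ)
    (hsub : ∀ s : ℝ, ∀ᵐ ω ∂μ, (μ[fun ω' => Real.exp (s * Y ω') | mβ.comap X]) ω ≤
      Real.exp (s ^ 2 * ρ ^ 2 / 2)) :
    ∀ᵐ w ∂(μ.map X), ∀ s : ℝ, ∫⁻ y, ENNReal.ofReal (Real.exp (s * y)) ∂(condDistrib Y X μ w) ≤
      ENNReal.ofReal (Real.exp (s ^ 2 * ρ ^ 2 / 2)) := by
  have h : Kernel.HasSubgaussianMGF id (Real.toNNReal (ρ ^ 2)) (condDistrib Y X μ) (μ.map X) := by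
    -- The hypothesis has an exceptional null set for each `s`. Rational parameters need only
    -- countably many of them and determine the bound for all real parameters.
    refine .of_rat ?_ ?_
    · intro t
      rw [condDistrib_comp_map hX.aemeasurable hY.aemeasurable]
      rw [integrable_map_measure (by fun_prop) hY.aemeasurable]
      exact hint t
    · intro q
      have h1 := condExp_ae_eq_integral_condDistrib hX hY.aemeasurable (μ := μ)
        (f := fun y => Real.exp ((q : ℝ) * y)) (by fun_prop) (hint q)
      have hmm : Measurable fun w => ∫ y, Real.exp ((q : ℝ) * y) ∂(condDistrib Y X μ w) :=
        (StronglyMeasurable.integral_condDistrib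
          (f := fun p : β × ℝ => Real.exp ((q : ℝ) * p.2)) (by fun_prop)).measurable
      rw [ae_map_iff hX.aemeasurable]
      · filter_upwards [h1, hsub q] with ω h2 h3
        rw [h2] at h3
        refine h3.trans (le_of_eq ?_)
        rw [Real.coe_toNNReal _ (by positivity)]
        ring_nf
      · exact measurableSet_le hmm measurable_const
  filter_upwards [h.mgf_le, h.ae_forall_integrable_exp_mul] with w h1 h2 s
  rw [← ofReal_integral_eq_lintegral_ofReal (f := fun y => Real.exp (s * y)) (h2 s)
    (ae_of_all _ fun _ => (Real.exp_nonneg _))]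
  refine ENNReal.ofReal_le_ofReal ((h1 s).trans (le_of_eq ?_))
  rw [Real.coe_toNNReal _ (by positivity)]
  ring_nf

lemma lintegral_mul_mixFactor_le_of_comap {Ω β : Type*} [MeasurableSpace Ω]
    [mβ : MeasurableSpace β]
    {μ : Measure Ω} [IsProbabilityMeasure μ] {X : Ω → β} (hX : Measurable X) {Y : Ω → ℝ}
    (hY : Measurable Y) {ρ : ℝ} (hρ : 0 < ρ)
    (hint : ∀ s : ℝ, Integrable (fun ω => Real.exp (s * Y ω)) μ)
    (hsub : ∀ s : ℝ, ∀ᵐ ω ∂μ, (μ[fun ω' => Real.exp (s * Y ω') | mβ.comap X]) ω ≤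
      Real.exp (s ^ 2 * ρ ^ 2 / 2))
    {a c : β → ℝ} {Z : β → ℝ≥0∞} (ha : Measurable a) (hc : Measurable c) (hZ : Measurable Z)
    (ha0 : ∀ w, 0 ≤ a w) (ha1 : ∀ w, a w < 1) :
    ∫⁻ ω, Z (X ω) * ENNReal.ofReal (mixFactor (a (X ω)) (c (X ω)) (Y ω / ρ)) ∂μ ≤
      ∫⁻ ω, Z (X ω) ∂μ := by
  have hmix : Measurable fun q : β × ℝ => ENNReal.ofReal (mixFactor (a q.1) (c q.1) (q.2 / ρ)) := by
    exact (measurable_mixFactor.comp ((ha.comp measurable_fst).prodMk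
      ((hc.comp measurable_fst).prodMk (measurable_snd.div_const ρ)))).ennreal_ofReal
  have hm : Measurable fun q : β × ℝ => Z q.1 * ENNReal.ofReal (mixFactor (a q.1) (c q.1) (q.2 / ρ)) :=
    (hZ.comp measurable_fst).mul hmix
  have e1 : ∫⁻ ω, Z (X ω) * ENNReal.ofReal (mixFactor (a (X ω)) (c (X ω)) (Y ω / ρ)) ∂μ =
      ∫⁻ q, Z q.1 * ENNReal.ofReal (mixFactor (a q.1) (c q.1) (q.2 / ρ))
        ∂(μ.map fun ω => (X ω, Y ω)) := by
    rw [lintegral_map hm (hX.prodMk hY)]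
  rw [e1, ← compProd_map_condDistrib hY.aemeasurable, Measure.lintegral_compProd hm]
  rw [← lintegral_map hZ hX]
  refine lintegral_mono_ae ?_
  filter_upwards [ae_condDistrib_lintegral_exp_le hX hY hint hsub] with w hw
  have := lintegral_mixFactor_le_one hρ hw (ha0 w) (ha1 w) (c w)
  rw [lintegral_const_mul _ (by exact hmix.comp measurable_prodMk_left)]
  calc _ ≤ Z w * 1 := by gcongr
    _ = Z w := mul_one _

lemma lintegral_mul_mixFactor_le {Ω : Type*} {m : MeasurableSpace Ω} [mΩ : MeasurableSpace Ω]
    {μ : Measure Ω} [IsProbabilityMeasure μ] (hm : m ≤ mΩ) {Y : Ω → ℝ}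
    (hY : Measurable Y) {ρ : ℝ} (hρ : 0 < ρ)
    (hint : ∀ s : ℝ, Integrable (fun ω => Real.exp (s * Y ω)) μ)
    (hsub : ∀ s : ℝ, ∀ᵐ ω ∂μ, (μ[fun ω' => Real.exp (s * Y ω') | m]) ω ≤
      Real.exp (s ^ 2 * ρ ^ 2 / 2))
    {a c : Ω → ℝ} {Z : Ω → ℝ≥0∞} (ha : Measurable[m] a) (hc : Measurable[m] c)
    (hZ : Measurable[m] Z) (ha0 : ∀ w, 0 ≤ a w) (ha1 : ∀ w, a w < 1) :
    ∫⁻ ω, Z ω * ENNReal.ofReal (mixFactor (a ω) (c ω) (Y ω / ρ)) ∂μ ≤ ∫⁻ ω, Z ω ∂μ := by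
  -- Conditioning on a sub-σ-algebra is conditioning on the identity map into `Ω` with that
  -- σ-algebra, which makes the conditional distribution available.
  have hX : @Measurable Ω Ω mΩ m id := fun s hs => hm s hs
  refine @lintegral_mul_mixFactor_le_of_comap Ω Ω mΩ m μ _ id hX Y hY ρ hρ hint ?_ a c Z ha hc hZ
    ha0 ha1
  simpa only [MeasurableSpace.comap_id] using hsub

/-! ### The filtration of the learner -/

section History

variable {d : ℕ} {Ω : Type*} {x : ℕ → Ω → Vec d} {ε : ℕ → Ω → ℝ}

lemma history_le [mΩ : MeasurableSpace Ω] (hx : ∀ t, Measurable (x t))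
    (hε : ∀ t, Measurable (ε t)) (t : ℕ) : history x ε t ≤ mΩ := by
  refine sup_le ?_ ?_
  · exact iSup₂_le fun k _ => (hx k).comap_le
  · exact iSup₂_le fun k _ => (hε k).comap_le

lemma measurable_action {k t : ℕ} (hk : k ∈ Finset.Icc 1 t) :
    Measurable[history x ε t] (x k) := by
  rw [measurable_iff_comap_le]
  exact (le_iSup₂ (f := fun k (_ : k ∈ Finset.Icc 1 t) =>
    MeasurableSpace.comap (x k) inferInstance) k hk).trans le_sup_left

lemma measurable_noise {k t : ℕ} (hk : k ∈ Finset.Ico 1 t) :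
    Measurable[history x ε t] (ε k) := by
  rw [measurable_iff_comap_le]
  exact (le_iSup₂ (f := fun k (_ : k ∈ Finset.Ico 1 t) =>
    MeasurableSpace.comap (ε k) inferInstance) k hk).trans le_sup_right

lemma history_mono {s t : ℕ} (hst : s ≤ t) : history x ε s ≤ history x ε t := by
  refine sup_le ?_ ?_
  · refine iSup₂_le fun k hk => measurable_iff_comap_le.1 (measurable_action ?_)
    simp only [Finset.mem_Icc] at hk ⊢; omega
  · refine iSup₂_le fun k hk => measurable_iff_comap_le.1 (measurable_noise ?_)
    simp only [Finset.mem_Ico] at hk ⊢; omega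

end History

/-- The exponential supermartingale mixture before round `t`. -/
def mixProd (a c e : ℕ → ℝ) (t : ℕ) : ℝ := ∏ k ∈ Finset.Ico 1 t, mixFactor (a k) (c k) (e k)

lemma mixProd_nonneg (a c e : ℕ → ℝ) (t : ℕ) : 0 ≤ mixProd a c e t :=
  Finset.prod_nonneg fun _ _ => mixFactor_nonneg _ _ _

lemma mixProd_succ (a c e : ℕ → ℝ) {t : ℕ} (ht : 1 ≤ t) :
    mixProd a c e (t + 1) = mixProd a c e t * mixFactor (a t) (c t) (e t) :=
  Finset.prod_Ico_succ_top ht _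

/-! ### The supermartingale and its maximal inequality -/

section Supermartingale

variable {d : ℕ} {Ω : Type*} {x : ℕ → Ω → Vec d} {ε : ℕ → Ω → ℝ} {T : ℕ} {ρ : ℝ} {a c : ℕ → Ω → ℝ}

lemma measurable_mixProd {t : ℕ}
    (ha : ∀ k ∈ Finset.Ico 1 t, Measurable[history x ε k] (a k))
    (hc : ∀ k ∈ Finset.Ico 1 t, Measurable[history x ε k] (c k)) :
    Measurable[history x ε t] fun ω =>
      mixProd (fun k => a k ω) (fun k => c k ω) (fun k => ε k ω / ρ) t := by
  unfold mixProd
  refine Finset.measurable_fun_prod _ fun k hk => ?_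
  have hle : history x ε k ≤ history x ε t := history_mono (Finset.mem_Ico.1 hk).2.le
  exact measurable_mixFactor.comp (((ha k hk).mono hle le_rfl).prodMk
    (((hc k hk).mono hle le_rfl).prodMk ((measurable_noise hk).div_const ρ)))

variable [mΩ : MeasurableSpace Ω] {μ : Measure Ω} [IsProbabilityMeasure μ]

lemma lintegral_mixProd_le_one (hx : ∀ t, Measurable (x t)) (hρ : 0 < ρ)
    (h : IsSubgaussianNoise μ T ρ x ε)
    (ha : ∀ k ∈ Finset.Icc 1 T, Measurable[history x ε k] (a k))
    (hc : ∀ k ∈ Finset.Icc 1 T, Measurable[history x ε k] (c k))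
    (ha0 : ∀ k ω, 0 ≤ a k ω) (ha1 : ∀ k ω, a k ω < 1) :
    ∀ t : ℕ, t ≤ T → ∫⁻ ω, ENNReal.ofReal
      (mixProd (fun k => a k ω) (fun k => c k ω) (fun k => ε k ω / ρ) (t + 1)) ∂μ ≤ 1 := by
  intro t
  induction t with
  | zero => intro _; simp [mixProd]
  | succ t ih =>
    intro ht
    refine le_trans ?_ (ih (by omega))
    have hmem : t + 1 ∈ Finset.Icc 1 T := by simp; omega
    have hsub : ∀ k ∈ Finset.Ico 1 (t + 1), k ∈ Finset.Icc 1 T := by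
      intro k hk; simp only [Finset.mem_Ico, Finset.mem_Icc] at hk ⊢; omega
    have hm := measurable_mixProd (ρ := ρ) (fun k hk => ha k (hsub k hk))
      (fun k hk => hc k (hsub k hk))
    have := lintegral_mul_mixFactor_le (μ := μ) (history_le hx h.measurable (t + 1))
      (h.measurable (t + 1)) hρ (h.integrable_exp _ hmem) (h.subgaussian _ hmem)
      (ha _ hmem) (hc _ hmem) hm.ennreal_ofReal (ha0 _) (ha1 _)
    refine le_trans (le_of_eq ?_) this
    congr 1
    ext ω
    rw [← ENNReal.ofReal_mul (mixProd_nonneg _ _ _ _), mixProd_succ _ _ _ (by omega : 1 ≤ t + 1)]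

open Classical in
/-- Ville's inequality for the mixture of exponential supermartingales. -/
lemma measure_exists_le_mixProd (hx : ∀ t, Measurable (x t)) (hρ : 0 < ρ)
    (h : IsSubgaussianNoise μ T ρ x ε)
    (ha : ∀ k ∈ Finset.Icc 1 T, Measurable[history x ε k] (a k))
    (hc : ∀ k ∈ Finset.Icc 1 T, Measurable[history x ε k] (c k))
    (ha0 : ∀ k ω, 0 ≤ a k ω) (ha1 : ∀ k ω, a k ω < 1) {δ : ℝ} (hδ : 0 < δ) :
    μ {ω | ∃ t ∈ Finset.Icc 1 (T + 1), δ⁻¹ ≤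
      mixProd (fun k => a k ω) (fun k => c k ω) (fun k => ε k ω / ρ) t} ≤ ENNReal.ofReal δ := by
  set M : ℕ → Ω → ℝ := fun t ω =>
    mixProd (fun k => a k ω) (fun k => c k ω) (fun k => ε k ω / ρ) t with hM
  let A : ℕ → Set Ω := fun k => {ω | ∃ j ∈ Finset.Icc 1 k, δ⁻¹ ≤ M j ω}
  have hA : ∀ k ∈ Finset.Icc 1 T, MeasurableSet[history x ε k] (A k) := by
    intro k hk
    have : A k = ⋃ j ∈ Finset.Icc 1 k, {ω | δ⁻¹ ≤ M j ω} := by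
      ext ω; simp [A]
    rw [this]
    refine Finset.measurableSet_biUnion _ fun j hj => ?_
    have hsub : ∀ i ∈ Finset.Ico 1 j, i ∈ Finset.Icc 1 T := by
      intro i hi; simp only [Finset.mem_Ico, Finset.mem_Icc] at hi hj hk ⊢; omega
    have hm : Measurable[history x ε j] (M j) :=
      measurable_mixProd (fun i hi => ha i (hsub i hi)) (fun i hi => hc i (hsub i hi))
    exact measurableSet_le measurable_const
      (hm.mono (history_mono (Finset.mem_Icc.1 hj).2) le_rfl)
  -- Zero coefficients give the factor 1, so this freezes the product once the level `δ⁻¹` has been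
  -- reached. The modified coefficients are still predictable, and Markov's inequality for the
  -- frozen product at the final time covers all earlier times.
  set a' : ℕ → Ω → ℝ := fun k ω => if ω ∈ A k then 0 else a k ω with ha'
  set c' : ℕ → Ω → ℝ := fun k ω => if ω ∈ A k then 0 else c k ω with hc'
  have h1 := lintegral_mixProd_le_one (a := a') (c := c') hx hρ h
    (fun k hk => Measurable.ite (hA k hk) measurable_const (ha k hk))
    (fun k hk => Measurable.ite (hA k hk) measurable_const (hc k hk))
    (fun k ω => by simp only [ha']; split_ifs; exacts [le_rfl, ha0 k ω])
    (fun k ω => by simp only [ha']; split_ifs; exacts [one_pos, ha1 k ω]) T le_rfl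
  set M' : ℕ → Ω → ℝ := fun t ω =>
    mixProd (fun k => a' k ω) (fun k => c' k ω) (fun k => ε k ω / ρ) t with hM'
  have le_final : ∀ ω, (∃ t ∈ Finset.Icc 1 (T + 1), δ⁻¹ ≤ M t ω) → δ⁻¹ ≤ M' (T + 1) ω := by
    intro ω hω
    have hex : ∃ t, t ∈ Finset.Icc 1 (T + 1) ∧ δ⁻¹ ≤ M t ω := hω
    obtain ⟨ht, hMt⟩ := Nat.find_spec hex
    have hmin := fun k => Nat.find_min (H := hex) (m := k)
    set t := Nat.find hex with htdef
    clear_value t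
    rw [Finset.mem_Icc] at ht
    have e1 : M' t ω = M t ω := by
      refine Finset.prod_congr rfl fun k hk => ?_
      rw [Finset.mem_Ico] at hk
      have : ω ∉ A k := by
        rintro ⟨j, hj, hj2⟩
        rw [Finset.mem_Icc] at hj
        exact hmin j (by omega) ⟨by rw [Finset.mem_Icc]; omega, hj2⟩
      simp [ha', hc', this]
    have e2 : M' (T + 1) ω = M' t ω := by
      refine (Finset.prod_subset (Finset.Ico_subset_Ico_right ht.2) fun k hk hk2 => ?_).symm
      rw [Finset.mem_Ico] at hk hk2
      have : ω ∈ A k := ⟨t, by rw [Finset.mem_Icc]; omega, hMt⟩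
      simp [ha', hc', this, mixFactor_zero]
    rw [e2, e1]
    exact hMt
  have hm' : Measurable (M' (T + 1)) := by
    have hsub : ∀ i ∈ Finset.Ico 1 (T + 1), i ∈ Finset.Icc 1 T := by
      intro i hi; simp only [Finset.mem_Ico, Finset.mem_Icc] at hi ⊢; omega
    refine Measurable.mono (measurable_mixProd (x := x)
      (fun k hk => Measurable.ite (hA k (hsub k hk)) measurable_const (ha k (hsub k hk)))
      (fun k hk => Measurable.ite (hA k (hsub k hk)) measurable_const (hc k (hsub k hk))))
      (history_le hx h.measurable (T + 1)) le_rfl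
  calc _ ≤ μ {ω | ENNReal.ofReal δ⁻¹ ≤ ENNReal.ofReal (M' (T + 1) ω)} :=
        measure_mono fun ω hω => ENNReal.ofReal_le_ofReal (le_final ω hω)
    _ ≤ (∫⁻ ω, ENNReal.ofReal (M' (T + 1) ω) ∂μ) / ENNReal.ofReal δ⁻¹ :=
        meas_ge_le_lintegral_div hm'.ennreal_ofReal.aemeasurable (by simpa using hδ)
          ENNReal.ofReal_ne_top
    _ ≤ 1 / ENNReal.ofReal δ⁻¹ := by gcongr
    _ = ENNReal.ofReal δ := by
        rw [ENNReal.ofReal_inv_of_pos hδ, one_div, inv_inv]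

/-- Subgaussian noise with constant `0` vanishes. -/
lemma IsSubgaussianNoise.ae_eq_zero (hx : ∀ t, Measurable (x t))
    (h : IsSubgaussianNoise μ T 0 x ε) {t : ℕ} (ht : t ∈ Finset.Icc 1 T) :
    ∀ᵐ ω ∂μ, ε t ω = 0 := by
  have hle := history_le hx h.measurable t
  have hint : ∀ s : ℝ, ∫ ω, Real.exp (s * ε t ω) ∂μ ≤ 1 := by
    intro s
    rw [← integral_condExp hle]
    calc _ ≤ ∫ _, (1 : ℝ) ∂μ := by
          refine integral_mono_ae integrable_condExp (integrable_const _) ?_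
          filter_upwards [h.subgaussian t ht s] with ω hω
          simpa using hω
      _ = 1 := by simp
  have hi1 := h.integrable_exp t ht 1
  have hi2 := h.integrable_exp t ht (-1)
  -- This nonnegative function vanishes only at `y = 0`; its mean along the noise is at most `1 + 1
  -- - 2 = 0`.
  have hpos : ∀ y : ℝ, 0 ≤ Real.exp (1 * y) + Real.exp (-1 * y) - 2 := by
    intro y
    linarith [Real.add_one_le_exp (1 * y), Real.add_one_le_exp (-1 * y)]
  have hi12 : Integrable (fun ω => Real.exp (1 * ε t ω) + Real.exp (-1 * ε t ω)) μ := hi1.add hi2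
  have hz : ∫ ω, (Real.exp (1 * ε t ω) + Real.exp (-1 * ε t ω) - 2) ∂μ = 0 := by
    refine le_antisymm ?_ (integral_nonneg fun ω => hpos _)
    rw [integral_sub hi12 (integrable_const _), integral_add hi1 hi2]
    have := hint 1
    have := hint (-1)
    simp only [integral_const, probReal_univ, one_smul]
    linarith
  rw [integral_eq_zero_iff_of_nonneg (fun ω => hpos _) (hi12.sub (integrable_const _))] at hz
  filter_upwards [hz] with ω hω
  simp only [Pi.zero_apply] at hω
  by_contra hne
  linarith [Real.add_one_lt_exp (x := 1 * ε t ω) (by simpa using hne),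
    Real.add_one_le_exp (-1 * ε t ω)]

end Supermartingale

/-! ### Rank-one updates, the elliptical potential and the telescoping mixture -/

section LinearAlgebra

variable {d : ℕ}

lemma dotProduct_inv_mulVec_nonneg {A : Matrix (Fin d) (Fin d) ℝ} (hA : A.PosDef)
    (v : Fin d → ℝ) : 0 ≤ v ⬝ᵥ (A⁻¹ *ᵥ v) := by
  simpa using hA.inv.posSemidef.dotProduct_mulVec_nonneg v

lemma dotProduct_mulVec_comm {A : Matrix (Fin d) (Fin d) ℝ} (hA : A.IsHermitian)
    (u v : Fin d → ℝ) : u ⬝ᵥ (A *ᵥ v) = v ⬝ᵥ (A *ᵥ u) := by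
  have h : Aᵀ = A := by simpa [IsHermitian, conjTranspose_eq_transpose_of_trivial] using hA
  rw [dotProduct_mulVec, dotProduct_comm, ← mulVec_transpose, h]

/-- The Cauchy-Schwarz inequality for the inner product given by `A⁻¹`. -/
lemma sq_dotProduct_inv_mulVec_le {A : Matrix (Fin d) (Fin d) ℝ} (hA : A.PosDef)
    (u v : Fin d → ℝ) :
    (u ⬝ᵥ (A⁻¹ *ᵥ v)) ^ 2 ≤ (u ⬝ᵥ (A⁻¹ *ᵥ u)) * (v ⬝ᵥ (A⁻¹ *ᵥ v)) := by
  have hc := dotProduct_mulVec_comm hA.inv.isHermitian u v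
  have h : ∀ r : ℝ, 0 ≤ (v ⬝ᵥ (A⁻¹ *ᵥ v)) * (r * r) + (2 * (u ⬝ᵥ (A⁻¹ *ᵥ v))) * r +
      (u ⬝ᵥ (A⁻¹ *ᵥ u)) := by
    intro r
    have := dotProduct_inv_mulVec_nonneg hA (u + r • v)
    simp only [mulVec_add, mulVec_smul, dotProduct_add, add_dotProduct, dotProduct_smul,
      smul_dotProduct, smul_eq_mul] at this
    rw [← hc] at this
    linarith
  have := discrim_le_zero h
  rw [discrim] at this
  linarith

/-- The Sherman–Morrison formula, checked by multiplying out. -/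
lemma inv_add_vecMulVec {A : Matrix (Fin d) (Fin d) ℝ} (hA : A.PosDef) (x : Fin d → ℝ) :
    (A + vecMulVec x x)⁻¹ = A⁻¹ -
      (1 + x ⬝ᵥ (A⁻¹ *ᵥ x))⁻¹ • vecMulVec (A⁻¹ *ᵥ x) (A⁻¹ *ᵥ x) := by
  have hdet : IsUnit A.det := hA.det_pos.ne'.isUnit
  have hw := dotProduct_inv_mulVec_nonneg hA x
  set w := x ⬝ᵥ (A⁻¹ *ᵥ x) with hwdef
  have hT : (A⁻¹)ᵀ = A⁻¹ := by
    simpa [IsHermitian, conjTranspose_eq_transpose_of_trivial] using hA.inv.isHermitian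
  have h1 : A * vecMulVec (A⁻¹ *ᵥ x) (A⁻¹ *ᵥ x) = vecMulVec x (A⁻¹ *ᵥ x) := by
    rw [mul_vecMulVec, mulVec_mulVec, mul_nonsing_inv _ hdet, one_mulVec]
  have h2 : vecMulVec x x * A⁻¹ = vecMulVec x (A⁻¹ *ᵥ x) := by
    rw [vecMulVec_mul, ← mulVec_transpose, hT]
  have h3 : vecMulVec x x * vecMulVec (A⁻¹ *ᵥ x) (A⁻¹ *ᵥ x) = w • vecMulVec x (A⁻¹ *ᵥ x) := by
    rw [vecMulVec_mul_vecMulVec, vecMulVec_smul]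
  refine inv_eq_right_inv ?_
  rw [mul_sub, add_mul, mul_nonsing_inv _ hdet, mul_smul_comm, add_mul, h1, h2, h3]
  have h4 : vecMulVec x (A⁻¹ *ᵥ x) + w • vecMulVec x (A⁻¹ *ᵥ x) =
      (1 + w) • vecMulVec x (A⁻¹ *ᵥ x) := by rw [add_smul, one_smul]
  rw [h4, smul_smul, inv_mul_cancel₀ (by positivity), one_smul, add_sub_cancel_right]

lemma dotProduct_inv_add_vecMulVec {A : Matrix (Fin d) (Fin d) ℝ} (hA : A.PosDef)
    (x s : Fin d → ℝ) :
    s ⬝ᵥ ((A + vecMulVec x x)⁻¹ *ᵥ s) = s ⬝ᵥ (A⁻¹ *ᵥ s) -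
      (s ⬝ᵥ (A⁻¹ *ᵥ x)) ^ 2 / (1 + x ⬝ᵥ (A⁻¹ *ᵥ x)) := by
  rw [inv_add_vecMulVec hA, sub_mulVec, dotProduct_sub, smul_mulVec, dotProduct_smul,
    vecMulVec_mulVec]
  simp only [op_smul_eq_smul, dotProduct_smul, smul_eq_mul]
  rw [dotProduct_comm (A⁻¹ *ᵥ x) s]
  field_simp

lemma det_add_vecMulVec {A : Matrix (Fin d) (Fin d) ℝ} (hA : A.PosDef) (x : Fin d → ℝ) :
    (A + vecMulVec x x).det = A.det * (1 + x ⬝ᵥ (A⁻¹ *ᵥ x)) := by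
  have hdet : IsUnit A.det := hA.det_pos.ne'.isUnit
  rw [vecMulVec_eq Unit, det_add_replicateCol_mul_replicateRow hdet]
  congr 1
  rw [det_unique, dotProduct_mulVec, ← replicateRow_vecMul]
  simp [mul_apply, dotProduct]

lemma det_le_trace_div_pow {A : Matrix (Fin d) (Fin d) ℝ} (hA : A.PosDef) (hd : 0 < d) :
    A.det ≤ (A.trace / d) ^ d := by
  have hH := hA.isHermitian
  have h1 : A.det = ∏ i, hH.eigenvalues i := by
    simpa using hH.det_eq_prod_eigenvalues
  have h2 : A.trace = ∑ i, hH.eigenvalues i := by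
    simpa using hH.trace_eq_sum_eigenvalues
  have hpos : ∀ i, 0 < hH.eigenvalues i := hA.eigenvalues_pos
  have h3 := Real.geom_mean_le_arith_mean Finset.univ (fun _ => (1 : ℝ)) hH.eigenvalues
    (fun _ _ => zero_le_one) (by simpa using hd) (fun i _ => (hpos i).le)
  simp only [Real.rpow_one, Finset.sum_const, Finset.card_univ, Fintype.card_fin, nsmul_eq_mul,
    mul_one, one_mul] at h3
  rw [h1, h2]
  have hP : 0 ≤ ∏ i, hH.eigenvalues i := Finset.prod_nonneg fun i _ => (hpos i).le
  calc ∏ i, hH.eigenvalues i = ((∏ i, hH.eigenvalues i) ^ ((d : ℝ)⁻¹)) ^ d := by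
        rw [← Real.rpow_natCast, ← Real.rpow_mul hP, inv_mul_cancel₀ (by positivity),
          Real.rpow_one]
    _ ≤ _ := by gcongr

variable {lam : ℝ} {x : ℕ → Vec d}

lemma gram_one (lam : ℝ) (x : ℕ → Vec d) : gram lam x 1 = lam • 1 := by simp [gram]

lemma gram_succ (lam : ℝ) (x : ℕ → Vec d) {t : ℕ} (ht : 1 ≤ t) :
    gram lam x (t + 1) = gram lam x t + vecMulVec (x t).ofLp (x t).ofLp := by
  rw [gram, Finset.sum_Ico_succ_top ht, gram]
  abel

lemma gram_posDef (hlam : 0 < lam) (x : ℕ → Vec d) (t : ℕ) : (gram lam x t).PosDef := by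
  unfold gram
  refine PosDef.posSemidef_add ?_ ?_
  · refine posSemidef_sum _ fun k _ => ?_
    simpa using posSemidef_vecMulVec_self_star (x k).ofLp
  · exact PosDef.one.smul hlam

lemma le_dotProduct_gram_mulVec (lam : ℝ) (x : ℕ → Vec d) (t : ℕ) (v : Fin d → ℝ) :
    lam * (v ⬝ᵥ v) ≤ v ⬝ᵥ (gram lam x t *ᵥ v) := by
  rw [gram, add_mulVec, dotProduct_add, smul_mulVec, one_mulVec, dotProduct_smul, smul_eq_mul]
  have : (∑ k ∈ Finset.Ico 1 t, vecMulVec (x k).ofLp (x k).ofLp).PosSemidef :=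
    posSemidef_sum _ fun k _ => by simpa using posSemidef_vecMulVec_self_star (x k).ofLp
  have := this.dotProduct_mulVec_nonneg v
  simp only [star_trivial] at this
  linarith

lemma dotProduct_self_eq_norm_sq (v : Vec d) : v.ofLp ⬝ᵥ v.ofLp = ‖v‖ ^ 2 := by
  rw [EuclideanSpace.norm_sq_eq]
  simp [dotProduct, sq]

lemma inner_eq_dotProduct (u v : Vec d) : inner ℝ u v = u.ofLp ⬝ᵥ v.ofLp := by
  rw [EuclideanSpace.inner_eq_star_dotProduct, star_trivial, dotProduct_comm]

/-- With `u = V⁻¹ v`, the bound `V ≥ lam` gives `lam ‖u‖² ≤ ⟨v, u⟩`, and Cauchy–Schwarz gives `⟨v,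
u⟩² ≤ ‖v‖² ‖u‖²`. Eliminating `‖u‖` proves the claim. -/
lemma mul_dotProduct_gram_inv_le (hlam : 0 < lam) (x : ℕ → Vec d) (t : ℕ) (v : Vec d) :
    lam * (v.ofLp ⬝ᵥ ((gram lam x t)⁻¹ *ᵥ v.ofLp)) ≤ ‖v‖ ^ 2 := by
  have hA := gram_posDef hlam x t
  set u := (gram lam x t)⁻¹ *ᵥ v.ofLp with hu
  have h1 : gram lam x t *ᵥ u = v.ofLp := by
    rw [hu, mulVec_mulVec, mul_nonsing_inv _ hA.det_pos.ne'.isUnit, one_mulVec]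
  have h2 := le_dotProduct_gram_mulVec lam x t u
  rw [h1, dotProduct_comm u v.ofLp] at h2
  have h3 : (v.ofLp ⬝ᵥ u) ^ 2 ≤ (v.ofLp ⬝ᵥ v.ofLp) * (u ⬝ᵥ u) := by
    have := Finset.sum_mul_sq_le_sq_mul_sq Finset.univ v.ofLp u
    simpa [dotProduct, sq] using this
  rw [dotProduct_self_eq_norm_sq] at h3
  have h4 : 0 ≤ v.ofLp ⬝ᵥ u := dotProduct_inv_mulVec_nonneg hA _
  rcases h4.eq_or_lt with h5 | h5
  · rw [← h5]; simp
  · have : (v.ofLp ⬝ᵥ u) * (lam * (v.ofLp ⬝ᵥ u)) ≤ (v.ofLp ⬝ᵥ u) * ‖v‖ ^ 2 := by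
      nlinarith [sq_nonneg ‖v‖]
    exact le_of_mul_le_mul_left this h5

/-- The squared width of the action in round `t`. -/
def actionWidthSq (lam : ℝ) (x : ℕ → Vec d) (t : ℕ) : ℝ :=
  (x t).ofLp ⬝ᵥ ((gram lam x t)⁻¹ *ᵥ (x t).ofLp)

lemma actionWidthSq_nonneg (hlam : 0 < lam) (x : ℕ → Vec d) (t : ℕ) :
    0 ≤ actionWidthSq lam x t :=
  dotProduct_inv_mulVec_nonneg (gram_posDef hlam x t) _

lemma weightedNorm_sq (hlam : 0 < lam) (x : ℕ → Vec d) (t : ℕ) (v : Vec d) :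
    weightedNorm (gram lam x t)⁻¹ v ^ 2 = v.ofLp ⬝ᵥ ((gram lam x t)⁻¹ *ᵥ v.ofLp) :=
  Real.sq_sqrt (dotProduct_inv_mulVec_nonneg (gram_posDef hlam x t) _)

lemma det_gram_succ (hlam : 0 < lam) (x : ℕ → Vec d) {t : ℕ} (ht : 1 ≤ t) :
    (gram lam x (t + 1)).det = (gram lam x t).det * (1 + actionWidthSq lam x t) := by
  rw [gram_succ _ _ ht, det_add_vecMulVec (gram_posDef hlam x t), actionWidthSq]

lemma det_gram_one : (gram lam x 1).det = lam ^ d := by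
  rw [gram_one]; simp

lemma trace_gram (lam : ℝ) (x : ℕ → Vec d) (t : ℕ) :
    (gram lam x t).trace = ∑ k ∈ Finset.Ico 1 t, ‖x k‖ ^ 2 + lam * d := by
  rw [gram, trace_add, trace_sum, trace_smul, trace_one]
  congr 1
  · exact Finset.sum_congr rfl fun k _ => by rw [trace_vecMulVec, dotProduct_self_eq_norm_sq]
  · simp

/-- The logarithm of the determinant, normalized. -/
def logDet (lam : ℝ) (x : ℕ → Vec d) (t : ℕ) : ℝ :=
  Real.log ((gram lam x t).det / lam ^ d)

lemma logDet_eq_sum (hlam : 0 < lam) (x : ℕ → Vec d) {t : ℕ} (ht : 1 ≤ t) :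
    logDet lam x t = ∑ k ∈ Finset.Ico 1 t, Real.log (1 + actionWidthSq lam x k) := by
  induction t, ht using Nat.le_induction with
  | base => rw [logDet, det_gram_one, div_self (by positivity)]; simp
  | succ t ht ih =>
    have h1 := (gram_posDef hlam x t).det_pos
    have h2 := actionWidthSq_nonneg hlam x t
    rw [Finset.sum_Ico_succ_top ht, ← ih, logDet, logDet, det_gram_succ hlam x ht,
      mul_div_right_comm, Real.log_mul (by positivity) (by positivity)]

lemma logDet_le (hlam : 0 < lam) (hd : 0 < d) {t : ℕ} (ht : 1 ≤ t)
    (hx : ∀ k ∈ Finset.Ico 1 t, ‖x k‖ ≤ 1) :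
    logDet lam x t ≤ d * Real.log (1 + ((t : ℝ) - 1) / (lam * d)) := by
  have hA := gram_posDef hlam x t
  have h1 := det_le_trace_div_pow hA hd
  have hd' : (0 : ℝ) < d := by exact_mod_cast hd
  have ht' : (1 : ℝ) ≤ t := by exact_mod_cast ht
  have h2 : (gram lam x t).trace ≤ ((t : ℝ) - 1) + lam * d := by
    rw [trace_gram]
    gcongr
    calc ∑ k ∈ Finset.Ico 1 t, ‖x k‖ ^ 2 ≤ ∑ k ∈ Finset.Ico 1 t, (1 : ℝ) :=
          Finset.sum_le_sum fun k hk => pow_le_one₀ (norm_nonneg _) (hx k hk)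
      _ = (t : ℝ) - 1 := by simp [Nat.cast_sub ht]
  rw [logDet, ← Real.log_pow]
  refine Real.log_le_log (div_pos hA.det_pos (by positivity)) ?_
  rw [div_le_iff₀ (by positivity), ← mul_pow]
  refine h1.trans ?_
  have h3 : 0 ≤ (gram lam x t).trace := by
    rw [trace_gram]; positivity
  have e : (1 + ((t : ℝ) - 1) / (lam * d)) * lam = (((t : ℝ) - 1) + lam * d) / d := by
    field_simp
    ring
  rw [e]
  gcongr

/-- Concavity puts `log (1 + y)` above its chord `y log 2`, and `log 2 > 2/3`. The customary factor
`2` would be too large: it would let the first phase last longer than the `2B̄` rounds that the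
regret bound accounts for. -/
lemma le_three_halves_log {y : ℝ} (h0 : 0 ≤ y) (h1 : y ≤ 1) : y ≤ 3 / 2 * Real.log (1 + y) := by
  have hc := strictConcaveOn_log_Ioi.concaveOn.2 (Set.mem_Ioi.2 (one_pos (α := ℝ)))
    (Set.mem_Ioi.2 (two_pos (α := ℝ))) (sub_nonneg.2 h1) h0 (by ring)
  simp only [smul_eq_mul, Real.log_one, mul_zero, zero_add, mul_one] at hc
  rw [show 1 - y + y * 2 = 1 + y by ring] at hc
  nlinarith [Real.log_two_gt_d9]

lemma sum_actionWidthSq_le (hlam : 1 ≤ lam) (hd : 0 < d) {t : ℕ} (ht : 1 ≤ t)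
    (hx : ∀ k ∈ Finset.Ico 1 t, ‖x k‖ ≤ 1) :
    ∑ k ∈ Finset.Ico 1 t, actionWidthSq lam x k ≤
      3 / 2 * (d * Real.log (1 + ((t : ℝ) - 1) / (lam * d))) := by
  have hlam0 : 0 < lam := by linarith
  refine le_trans ?_ (mul_le_mul_of_nonneg_left (logDet_le hlam0 hd ht hx) (by norm_num))
  rw [logDet_eq_sum hlam0 x ht, Finset.mul_sum]
  refine Finset.sum_le_sum fun k hk => le_three_halves_log (actionWidthSq_nonneg hlam0 x k) ?_
  have h1 := mul_dotProduct_gram_inv_le hlam0 x k (x k)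
  have h2 := actionWidthSq_nonneg hlam0 x k
  have h3 : ‖x k‖ ^ 2 ≤ 1 := pow_le_one₀ (norm_nonneg _) (hx k hk)
  unfold actionWidthSq at *
  nlinarith

/-- The weighted sum of the actions before round `t`. -/
def weightedSum (w : ℕ → ℝ) (x : ℕ → Vec d) (t : ℕ) : Vec d := ∑ k ∈ Finset.Ico 1 t, w k • x k

lemma weightedSum_succ (w : ℕ → ℝ) (x : ℕ → Vec d) {t : ℕ} (ht : 1 ≤ t) :
    weightedSum w x (t + 1) = weightedSum w x t + w t • x t :=
  Finset.sum_Ico_succ_top ht _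

/-- The coefficient of the square of the noise in `mixFactor`. -/
def mixQuad (lam : ℝ) (x : ℕ → Vec d) (t : ℕ) : ℝ :=
  actionWidthSq lam x t / (1 + actionWidthSq lam x t)

/-- The coefficient of the noise in `mixFactor`. -/
def mixLin (lam : ℝ) (e : ℕ → ℝ) (x : ℕ → Vec d) (t : ℕ) : ℝ :=
  ((weightedSum e x t).ofLp ⬝ᵥ ((gram lam x t)⁻¹ *ᵥ (x t).ofLp)) / (1 + actionWidthSq lam x t)

lemma mixQuad_nonneg (hlam : 0 < lam) (x : ℕ → Vec d) (t : ℕ) : 0 ≤ mixQuad lam x t := by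
  have := actionWidthSq_nonneg hlam x t
  unfold mixQuad; positivity

lemma mixQuad_lt_one (hlam : 0 < lam) (x : ℕ → Vec d) (t : ℕ) : mixQuad lam x t < 1 := by
  have := actionWidthSq_nonneg hlam x t
  rw [mixQuad, div_lt_one (by positivity)]
  linarith

lemma mixFactor_exponent {w q e : ℝ} (hw : 0 ≤ w) :
    mixFactor (w / (1 + w)) (q / (1 + w)) e =
      √((1 + w)⁻¹) * Real.exp ((2 * e * q + e ^ 2 * w - (q + e * w) ^ 2 / (1 + w)) / 2) := by
  have h1 : 1 - w / (1 + w) = (1 + w)⁻¹ := by field_simp; ring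
  rw [mixFactor, h1]
  congr 2
  field_simp
  ring

/-- With `w` the squared width of `x_t` and `q = S_tᵀ V_t⁻¹ x_t`, Sherman–Morrison shows that one
update changes the quadratic form by `2 e q + e² w - (q + e w)² / (1 + w)`, while the determinant
gains the factor `1 + w`. The coefficients `mixQuad` and `mixLin` are chosen so that `mixFactor` is
precisely this change. -/
lemma mixProd_eq (hlam : 0 < lam) (e : ℕ → ℝ) (x : ℕ → Vec d) {t : ℕ} (ht : 1 ≤ t) :
    mixProd (mixQuad lam x) (mixLin lam e x) e t = √(lam ^ d / (gram lam x t).det) *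
      Real.exp (((weightedSum e x t).ofLp ⬝ᵥ
        ((gram lam x t)⁻¹ *ᵥ (weightedSum e x t).ofLp)) / 2) := by
  induction t, ht using Nat.le_induction with
  | base => rw [det_gram_one, div_self (by positivity)]; simp [mixProd, weightedSum]
  | succ t ht ih =>
    have hA := gram_posDef hlam x t
    have h1 := hA.det_pos
    have h2 := actionWidthSq_nonneg hlam x t
    have hc := dotProduct_mulVec_comm hA.inv.isHermitian (x t).ofLp (weightedSum e x t).ofLp
    rw [mixProd_succ _ _ _ ht, ih, mixQuad, mixLin, mixFactor_exponent h2,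
      det_gram_succ hlam x ht, gram_succ _ _ ht, dotProduct_inv_add_vecMulVec hA,
      weightedSum_succ _ _ ht]
    rw [mul_mul_mul_comm, ← Real.exp_add, ← Real.sqrt_mul (by positivity), ← div_eq_mul_inv,
      div_div]
    congr 2
    simp only [WithLp.ofLp_add, WithLp.ofLp_smul, mulVec_add, mulVec_smul, dotProduct_add,
      add_dotProduct, dotProduct_smul, smul_dotProduct, smul_eq_mul, hc]
    rw [show (x t).ofLp ⬝ᵥ ((gram lam x t)⁻¹ *ᵥ (x t).ofLp) = actionWidthSq lam x t from rfl]
    ring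

lemma dotProduct_le_of_mixProd_lt (hlam : 0 < lam) {e : ℕ → ℝ} {t : ℕ}
    (ht : 1 ≤ t) {δ : ℝ}
    (h : mixProd (mixQuad lam x) (mixLin lam e x) e t < δ⁻¹) :
    (weightedSum e x t).ofLp ⬝ᵥ ((gram lam x t)⁻¹ *ᵥ (weightedSum e x t).ofLp) ≤
      logDet lam x t + 2 * Real.log (1 / δ) := by
  have h1 := (gram_posDef hlam x t).det_pos
  rw [mixProd_eq hlam e x ht] at h
  have h2 := Real.log_lt_log (by positivity) h
  rw [Real.log_mul (by positivity) (by positivity), Real.log_exp, Real.log_sqrt (by positivity),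
    ← inv_div (gram lam x t).det, Real.log_inv, Real.log_inv] at h2
  rw [logDet, one_div, Real.log_inv]
  linarith

end LinearAlgebra

end SafeBandit

namespace SafeBandit
open scoped ENNReal

/-! ### Self-normalized tail bounds -/

section SelfNormalized

variable {d m : ℕ} {Ω : Type*}

/-- By Cramer's rule an entry of the inverse is the reciprocal of a polynomial times a polynomial;
singular matrices need no separate treatment. -/
lemma measurable_matrix_inv_apply (i j : Fin m) :
    Measurable fun A : Fin m → Fin m → ℝ => (Matrix.of A)⁻¹ i j := by
  have h0 : Continuous fun A : Fin m → Fin m → ℝ => Matrix.of A := continuous_id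
  have h1 : Continuous fun A : Fin m → Fin m → ℝ => (Matrix.of A).det := h0.matrix_det
  have h2 : Continuous fun A : Fin m → Fin m → ℝ => (Matrix.of A).adjugate i j :=
    h0.matrix_adjugate.matrix_elem i j
  have : (fun A : Fin m → Fin m → ℝ => (Matrix.of A)⁻¹ i j) =
      fun A => ((Matrix.of A).det)⁻¹ * (Matrix.of A).adjugate i j := by
    ext A
    rw [inv_def, Ring.inverse_eq_inv', Matrix.smul_apply, smul_eq_mul]
  rw [this]
  exact h1.measurable.inv.mul h2.measurable

lemma measurable_dotProduct_gram_inv [MeasurableSpace Ω] {X : ℕ → Ω → Vec m} {t : ℕ}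
    (hX : ∀ k ∈ Finset.Ico 1 t, Measurable (X k)) {lam : ℝ} {u v : Ω → Vec m}
    (hu : Measurable u) (hv : Measurable v) :
    Measurable fun ω =>
      (u ω).ofLp ⬝ᵥ ((gram lam (fun k => X k ω) t)⁻¹ *ᵥ (v ω).ofLp) := by
  have hcoord : ∀ {w : Ω → Vec m}, Measurable w → ∀ i, Measurable fun ω => (w ω).ofLp i := by
    intro w hw i
    exact (EuclideanSpace.proj (𝕜 := ℝ) i).continuous.measurable.comp hw
  have hg : Measurable fun ω => (fun i j => gram lam (fun k => X k ω) t i j :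
      Fin m → Fin m → ℝ) := by
    refine measurable_pi_lambda _ fun i => measurable_pi_lambda _ fun j => ?_
    simp only [gram, Matrix.add_apply, Matrix.sum_apply, vecMulVec_apply]
    refine Measurable.add ?_ measurable_const
    exact Finset.measurable_fun_sum _ fun k hk =>
      (hcoord (hX k hk) i).mul (hcoord (hX k hk) j)
  simp only [dotProduct, mulVec]
  refine Finset.measurable_fun_sum _ fun i _ => (hcoord hu i).mul ?_
  exact Finset.measurable_fun_sum _ fun j _ =>
    ((measurable_matrix_inv_apply i j).comp hg).mul (hcoord hv j)

lemma weightedSum_div (e : ℕ → ℝ) (r : ℝ) (X : ℕ → Vec m) (t : ℕ) :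
    weightedSum (fun k => e k / r) X t = r⁻¹ • weightedSum e X t := by
  simp only [weightedSum, Finset.smul_sum, smul_smul]
  exact Finset.sum_congr rfl fun k _ => by rw [div_eq_inv_mul]

variable [mΩ : MeasurableSpace Ω] {μ : Measure Ω} [IsProbabilityMeasure μ]
  {x : ℕ → Ω → Vec d} {ε : ℕ → Ω → ℝ} {T : ℕ} {ρ : ℝ}

/-- The self-normalized tail bound for a predictable sequence of vectors. -/
theorem measure_selfNormalized_le (hx : ∀ t, Measurable (x t)) (hρ : 0 ≤ ρ)
    (h : IsSubgaussianNoise μ T ρ x ε) {X : ℕ → Ω → Vec m}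
    (hX : ∀ k ∈ Finset.Icc 1 T, Measurable[history x ε k] (X k)) {lam : ℝ} (hlam : 1 ≤ lam)
    {δ : ℝ} (hδ : 0 < δ) :
    μ {ω | ¬ ∀ t ∈ Finset.Icc 1 (T + 1),
      (weightedSum (fun k => ε k ω) (fun k => X k ω) t).ofLp ⬝ᵥ
        ((gram lam (fun k => X k ω) t)⁻¹ *ᵥ
          (weightedSum (fun k => ε k ω) (fun k => X k ω) t).ofLp) ≤
      ρ ^ 2 * (logDet lam (fun k => X k ω) t + 2 * Real.log (1 / δ))} ≤ ENNReal.ofReal δ := by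
  have hlam0 : 0 < lam := by linarith
  have hsub : ∀ t ∈ Finset.Icc 1 (T + 1), ∀ k ∈ Finset.Ico 1 t, k ∈ Finset.Icc 1 T := by
    intro t ht k hk; simp only [Finset.mem_Ico, Finset.mem_Icc] at hk ht ⊢; omega
  -- The supermartingale is built from `ε / ρ`, so `ρ = 0` is separate: then the noise vanishes
  -- almost surely.
  rcases hρ.eq_or_lt with hρ0 | hρ0
  · subst hρ0
    have hz : ∀ᵐ ω ∂μ, ∀ k ∈ Finset.Icc 1 T, ε k ω = 0 :=
      (Finset.eventually_all _).2 fun k hk => h.ae_eq_zero hx hk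
    refine le_trans (le_of_eq ?_) zero_le
    rw [← ae_iff]
    filter_upwards [hz] with ω hω t ht
    have : weightedSum (fun k => ε k ω) (fun k => X k ω) t = 0 :=
      Finset.sum_eq_zero fun k hk => by simp only [hω k (hsub t ht k hk), zero_smul]
    rw [this]
    simp
  have hXm : ∀ t ∈ Finset.Icc 1 T, ∀ k ∈ Finset.Icc 1 t, Measurable[history x ε t] (X k) := by
    intro t ht k hk
    simp only [Finset.mem_Icc] at ht hk
    exact (hX k (by simp; omega)).mono (history_mono hk.2) le_rfl
  have hw : ∀ t ∈ Finset.Icc 1 T, Measurable[history x ε t] fun ω =>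
      actionWidthSq lam (fun k => X k ω) t := by
    intro t ht
    have ht' := Finset.mem_Icc.1 ht
    exact @measurable_dotProduct_gram_inv m Ω (history x ε t) X t
      (fun k hk => hXm t ht k (by simp only [Finset.mem_Ico, Finset.mem_Icc] at hk ⊢; omega)) lam
      (X t) (X t) (hX t ht) (hX t ht)
  have key := measure_exists_le_mixProd hx hρ0 h
    (a := fun t ω => mixQuad lam (fun k => X k ω) t)
    (c := fun t ω => mixLin lam (fun k => ε k ω / ρ) (fun k => X k ω) t)
    (fun t ht => (hw t ht).div (measurable_const.add (hw t ht)))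
    (fun t ht => by
      have ht' := Finset.mem_Icc.1 ht
      have hXt : ∀ k ∈ Finset.Ico 1 t, Measurable[history x ε t] (X k) := fun k hk =>
        hXm t ht k (by simp only [Finset.mem_Ico, Finset.mem_Icc] at hk ⊢; omega)
      refine Measurable.div ?_ (measurable_const.add (hw t ht))
      refine @measurable_dotProduct_gram_inv m Ω (history x ε t) X t hXt lam
        (fun ω => weightedSum (fun k => ε k ω / ρ) (fun k => X k ω) t) (X t) ?_ (hX t ht)
      unfold weightedSum
      exact Finset.measurable_fun_sum _ fun k hk =>
        ((measurable_noise hk).div_const ρ).smul (hXt k hk))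
    (fun t ω => mixQuad_nonneg hlam0 _ _) (fun t ω => mixQuad_lt_one hlam0 _ _) hδ
  refine le_trans (measure_mono fun ω hω => ?_) key
  simp only [Set.mem_ofPred_eq] at hω ⊢
  by_contra hcon
  push Not at hcon
  refine hω fun t ht => ?_
  have h1 := dotProduct_le_of_mixProd_lt hlam0 (Finset.mem_Icc.1 ht).1 (hcon t ht)
  rw [weightedSum_div] at h1
  simp only [WithLp.ofLp_smul, mulVec_smul, dotProduct_smul, smul_dotProduct, smul_eq_mul] at h1
  rw [← mul_assoc, ← mul_inv, ← sq, inv_mul_le_iff₀ (by positivity)] at h1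
  exact h1

end SelfNormalized

/-! ### The scalar case -/

section OneDim

lemma gram_single (lam : ℝ) (g : ℕ → ℝ) (t : ℕ) :
    gram lam (fun k => EuclideanSpace.single (0 : Fin 1) (g k)) t 0 0 =
      lam + ∑ k ∈ Finset.Ico 1 t, g k ^ 2 := by
  simp only [gram, Matrix.add_apply, Matrix.sum_apply, vecMulVec_apply, Matrix.smul_apply, one_apply_eq]
  simp [sq, add_comm]

variable {d : ℕ} {Ω : Type*} [mΩ : MeasurableSpace Ω] {μ : Measure Ω} [IsProbabilityMeasure μ]
  {x : ℕ → Ω → Vec d} {ε : ℕ → Ω → ℝ} {T : ℕ} {ρ : ℝ}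

/-- The self-normalized tail bound for a predictable sequence of scalars. -/
theorem measure_selfNormalized_one_le (hx : ∀ t, Measurable (x t)) (hρ : 0 ≤ ρ)
    (h : IsSubgaussianNoise μ T ρ x ε) {g : ℕ → Ω → ℝ}
    (hg : ∀ k ∈ Finset.Icc 1 T, Measurable[history x ε k] (g k)) {lam : ℝ} (hlam : 1 ≤ lam)
    {δ : ℝ} (hδ : 0 < δ) :
    μ {ω | ¬ ∀ t ∈ Finset.Icc 1 (T + 1),
      (∑ k ∈ Finset.Ico 1 t, g k ω * ε k ω) ^ 2 / (lam + ∑ k ∈ Finset.Ico 1 t, g k ω ^ 2) ≤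
      ρ ^ 2 * (Real.log ((lam + ∑ k ∈ Finset.Ico 1 t, g k ω ^ 2) / lam) + 2 * Real.log (1 / δ))}
      ≤ ENNReal.ofReal δ := by
  have key := measure_selfNormalized_le hx hρ h
    (X := fun k ω => EuclideanSpace.single (0 : Fin 1) (g k ω)) (fun k hk => by
      have : (fun ω => EuclideanSpace.single (0 : Fin 1) (g k ω)) =
          fun ω => g k ω • EuclideanSpace.single (0 : Fin 1) (1 : ℝ) := by
        ext ω i; simp
      rw [this]
      exact (hg k hk).smul_const _) hlam hδ
  convert key using 7 with ω t ht
  have hs : (weightedSum (fun k => ε k ω) (fun k => EuclideanSpace.single (0 : Fin 1) (g k ω))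
      t).ofLp 0 = ∑ k ∈ Finset.Ico 1 t, g k ω * ε k ω := by
    simp [weightedSum, mul_comm]
  rw [logDet, det_unique, Fin.default_eq_zero, gram_single, pow_one]
  simp only [dotProduct, mulVec, Finset.univ_unique, Fin.default_eq_zero,
    Finset.sum_singleton, hs, inv_subsingleton, diagonal_apply_eq, gram_single,
    Ring.inverse_eq_inv']
  rw [div_eq_mul_inv, sq, mul_assoc, mul_comm (_⁻¹)]

end OneDim

/-! ### Confidence bounds for the estimators -/

section Confidence

variable {d : ℕ} {lam : ℝ} {x : ℕ → Vec d}

lemma gram_mulVec (lam : ℝ) (x : ℕ → Vec d) (t : ℕ) (θ : Vec d) :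
    gram lam x t *ᵥ θ.ofLp =
      (weightedSum (fun k => inner ℝ θ (x k)) x t).ofLp + lam • θ.ofLp := by
  rw [gram, add_mulVec, smul_mulVec, one_mulVec, sum_mulVec, weightedSum, WithLp.ofLp_sum]
  congr 1
  refine Finset.sum_congr rfl fun k _ => ?_
  rw [vecMulVec_mulVec, op_smul_eq_smul, WithLp.ofLp_smul, inner_eq_dotProduct, dotProduct_comm]

/-- The observations sum to `V_t θ + S_t - lam θ`, so the estimation error is `V_t⁻¹ (S_t - lam θ)`:
a noise part and a regularization bias. -/
lemma inner_estimator_sub (hlam : 0 < lam) (θ : Vec d) (e : ℕ → ℝ) (t : ℕ) (v : Vec d) :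
    inner ℝ (estimator lam x (fun k => inner ℝ θ (x k) + e k) t - θ) v =
      v.ofLp ⬝ᵥ ((gram lam x t)⁻¹ *ᵥ (weightedSum e x t).ofLp) -
        lam * (v.ofLp ⬝ᵥ ((gram lam x t)⁻¹ *ᵥ θ.ofLp)) := by
  have hdet : IsUnit (gram lam x t).det := (gram_posDef hlam x t).det_pos.ne'.isUnit
  have h1 : (∑ k ∈ Finset.Ico 1 t, (inner ℝ θ (x k) + e k) • x k).ofLp =
      gram lam x t *ᵥ θ.ofLp + (weightedSum e x t).ofLp - lam • θ.ofLp := by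
    rw [gram_mulVec]
    simp only [add_smul, Finset.sum_add_distrib, WithLp.ofLp_add, weightedSum]
    abel
  rw [inner_sub_left, inner_eq_dotProduct, inner_eq_dotProduct, estimator, h1, mulVec_sub,
    mulVec_add, mulVec_mulVec, nonsing_inv_mul _ hdet, one_mulVec, mulVec_smul]
  rw [dotProduct_comm _ v.ofLp, dotProduct_sub, dotProduct_add, dotProduct_smul, smul_eq_mul,
    dotProduct_comm θ.ofLp]
  ring

lemma abs_inner_estimator_sub_le (hlam : 0 < lam) {θ : Vec d} {e : ℕ → ℝ} {t : ℕ} {r : ℝ}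
    (hr : 0 ≤ r)
    (h : (weightedSum e x t).ofLp ⬝ᵥ ((gram lam x t)⁻¹ *ᵥ (weightedSum e x t).ofLp) ≤ r ^ 2)
    (v : Vec d) :
    |inner ℝ (estimator lam x (fun k => inner ℝ θ (x k) + e k) t - θ) v| ≤
      (r + √lam * ‖θ‖) * weightedNorm (gram lam x t)⁻¹ v := by
  have hA := gram_posDef hlam x t
  set n := weightedNorm (gram lam x t)⁻¹ v with hn
  have hn0 : 0 ≤ n := Real.sqrt_nonneg _
  have hn2 : n ^ 2 = v.ofLp ⬝ᵥ ((gram lam x t)⁻¹ *ᵥ v.ofLp) := weightedNorm_sq hlam x t v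
  have h1 : |v.ofLp ⬝ᵥ ((gram lam x t)⁻¹ *ᵥ (weightedSum e x t).ofLp)| ≤ r * n := by
    refine abs_le_of_sq_le_sq ?_ (by positivity)
    refine (sq_dotProduct_inv_mulVec_le hA _ _).trans ?_
    rw [← hn2, mul_pow, mul_comm]
    gcongr
  have h2 : |lam * (v.ofLp ⬝ᵥ ((gram lam x t)⁻¹ *ᵥ θ.ofLp))| ≤ √lam * ‖θ‖ * n := by
    refine abs_le_of_sq_le_sq ?_ (by positivity)
    have h3 := sq_dotProduct_inv_mulVec_le hA v.ofLp θ.ofLp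
    have h4 := mul_dotProduct_gram_inv_le hlam x t θ
    rw [← hn2] at h3
    rw [mul_pow, mul_pow, mul_pow, Real.sq_sqrt hlam.le]
    calc _ ≤ lam ^ 2 * (n ^ 2 * (θ.ofLp ⬝ᵥ ((gram lam x t)⁻¹ *ᵥ θ.ofLp))) := by gcongr
      _ = lam * n ^ 2 * (lam * (θ.ofLp ⬝ᵥ ((gram lam x t)⁻¹ *ᵥ θ.ofLp))) := by ring
      _ ≤ lam * n ^ 2 * ‖θ‖ ^ 2 := by gcongr
      _ = _ := by ring
  rw [inner_estimator_sub hlam]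
  refine (abs_sub _ _).trans ?_
  linarith

lemma abs_inner_estimator_sub_le_width {p : Params} (hp : p.Valid) (hd : 2 ≤ d) {θ : Vec d}
    (hθ : ‖θ‖ ≤ p.S) {e : ℕ → ℝ} {t : ℕ} (ht : 1 ≤ t)
    (hx : ∀ k ∈ Finset.Ico 1 t, ‖x k‖ ≤ 1)
    (h : (weightedSum e x t).ofLp ⬝ᵥ ((gram p.lam x t)⁻¹ *ᵥ (weightedSum e x t).ofLp) ≤
      p.ρ ^ 2 * (logDet p.lam x t + 2 * Real.log (1 / (p.δ / 2)))) (v : Vec d) :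
    |inner ℝ (estimator p.lam x (fun k => inner ℝ θ (x k) + e k) t - θ) v| ≤ width p x t v := by
  have hlam : 0 < p.lam := by linarith [hp.one_le_lam]
  have hδ := hp.δ_pos
  have hρ := hp.ρ_nonneg
  have ht' : (0 : ℝ) ≤ (t : ℝ) - 1 := by
    have : (1 : ℝ) ≤ t := by exact_mod_cast ht
    linarith
  have hd' : (2 : ℝ) ≤ d := by exact_mod_cast hd
  have hq : 0 ≤ ((t : ℝ) - 1) / p.lam := by positivity
  have hL : 0 ≤ Real.log (1 / (p.δ / 2)) := Real.log_nonneg (by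
    rw [le_div_iff₀ (by positivity)]; linarith [hp.δ_lt_one])
  have hlog : Real.log ((1 + ((t : ℝ) - 1) / p.lam) / (p.δ / 2)) =
      Real.log (1 + ((t : ℝ) - 1) / p.lam) + Real.log (1 / (p.δ / 2)) := by
    rw [div_eq_mul_one_div, Real.log_mul (by positivity) (by positivity)]
  have hmain : logDet p.lam x t + 2 * Real.log (1 / (p.δ / 2)) ≤
      d * Real.log ((1 + ((t : ℝ) - 1) / p.lam) / (p.δ / 2)) := by
    rw [hlog, mul_add]
    -- The second summand is where `d ≥ 2` enters: the tail bound costs `2 log (2 / δ)`, and the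
    -- radius provides `d log (2 / δ)`.
    refine add_le_add ((logDet_le hlam (by omega) ht hx).trans ?_) (by gcongr)
    have : ((t : ℝ) - 1) / (p.lam * d) ≤ ((t : ℝ) - 1) / p.lam := by
      gcongr
      nlinarith
    gcongr
  have h0 : 0 ≤ Real.log ((1 + ((t : ℝ) - 1) / p.lam) / (p.δ / 2)) := by
    rw [hlog]
    have := Real.log_nonneg (show 1 ≤ 1 + ((t : ℝ) - 1) / p.lam by linarith)
    positivity
  refine (abs_inner_estimator_sub_le hlam
    (r := p.ρ * √(d * Real.log ((1 + ((t : ℝ) - 1) / p.lam) / (p.δ / 2)))) (by positivity) ?_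
    v).trans ?_
  · rw [mul_pow, Real.sq_sqrt (by positivity)]
    exact h.trans (by gcongr)
  · rw [width, radius]
    have : 0 ≤ weightedNorm (gram p.lam x t)⁻¹ v := Real.sqrt_nonneg _
    gcongr

end Confidence

/-! ### Estimates of the confidence radius -/

section Radius

variable {p : Params}

lemma Params.Valid.lam_pos (hp : p.Valid) : 0 < p.lam := by linarith [hp.one_le_lam]

lemma Params.Valid.S_pos (hp : p.Valid) : 0 < p.S := lt_max_of_lt_left hp.Sa_pos

lemma radius_mono (hp : p.Valid) (m : ℕ) {s r : ℝ} (hs : 1 ≤ s) (hsr : s ≤ r) :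
    radius p m s ≤ radius p m r := by
  have h1 := hp.ρ_nonneg
  have h2 := hp.lam_pos
  have h3 := hp.δ_pos
  have h4 : 0 ≤ (s - 1) / p.lam := div_nonneg (by linarith) h2.le
  unfold radius
  gcongr

lemma sqrt_lam_mul_S_le_radius (hp : p.Valid) (m : ℕ) (s : ℝ) : √p.lam * p.S ≤ radius p m s := by
  have h1 := hp.ρ_nonneg
  unfold radius
  have : 0 ≤ p.ρ * √(m * Real.log ((1 + (s - 1) / p.lam) / (p.δ / 2))) := by positivity
  linarith

lemma S_le_radius (hp : p.Valid) (m : ℕ) (s : ℝ) : p.S ≤ radius p m s := by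
  refine le_trans ?_ (sqrt_lam_mul_S_le_radius hp m s)
  exact le_mul_of_one_le_left hp.S_pos.le (Real.one_le_sqrt.2 hp.one_le_lam)

lemma radius_pos (hp : p.Valid) (m : ℕ) (s : ℝ) : 0 < radius p m s :=
  hp.S_pos.trans_le (S_le_radius hp m s)

lemma log_radius_arg (hp : p.Valid) {s : ℝ} (hs : 1 ≤ s) :
    Real.log ((1 + (s - 1) / p.lam) / (p.δ / 2)) =
      Real.log (1 + (s - 1) / p.lam) + Real.log (2 / p.δ) := by
  have h3 := hp.δ_pos
  have h4 : 0 ≤ (s - 1) / p.lam := div_nonneg (by linarith) hp.lam_pos.le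
  rw [← Real.log_mul (by positivity) (by positivity)]
  congr 1
  field_simp

lemma log_two_div_nonneg (hp : p.Valid) : 0 ≤ Real.log (2 / p.δ) :=
  Real.log_nonneg (by rw [le_div_iff₀ hp.δ_pos]; linarith [hp.δ_lt_one])

/-- The constant in the bound of `radius` by the dimension and the logarithm of the time. -/
def Params.radiusConst (p : Params) : ℝ :=
  2 * (p.ρ ^ 2 * (1 + Real.log (2 / p.δ))) + 2 * (p.lam * p.S ^ 2)

lemma radiusConst_nonneg (hp : p.Valid) : 0 ≤ p.radiusConst := by
  have h1 := log_two_div_nonneg hp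
  have h2 := hp.lam_pos
  unfold Params.radiusConst; positivity

lemma radius_sq_le (hp : p.Valid) {m : ℕ} (hm : 1 ≤ m) {s : ℝ} (hs : 1 ≤ s) :
    radius p m s ^ 2 ≤ m * p.radiusConst * (1 + Real.log s) := by
  have h1 := log_two_div_nonneg hp
  have h2 := hp.lam_pos
  have h5 : 0 ≤ Real.log s := Real.log_nonneg hs
  have h6 : Real.log (1 + (s - 1) / p.lam) ≤ Real.log s := by
    have h4 : 0 ≤ (s - 1) / p.lam := div_nonneg (by linarith) h2.le
    refine Real.log_le_log (by positivity) ?_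
    have : (s - 1) / p.lam ≤ s - 1 := div_le_self (by linarith) hp.one_le_lam
    linarith
  have h4 : 0 ≤ Real.log (1 + (s - 1) / p.lam) := Real.log_nonneg (by
    have : 0 ≤ (s - 1) / p.lam := div_nonneg (by linarith) h2.le
    linarith)
  have hm' : (1 : ℝ) ≤ m := by exact_mod_cast hm
  rw [radius, log_radius_arg hp hs]
  set A := Real.log (1 + (s - 1) / p.lam) + Real.log (2 / p.δ) with hA
  have hA0 : 0 ≤ A := by positivity
  have hA1 : A ≤ (1 + Real.log (2 / p.δ)) * (1 + Real.log s) := by nlinarith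
  calc (p.ρ * √(m * A) + √p.lam * p.S) ^ 2
      ≤ 2 * (p.ρ * √(m * A)) ^ 2 + 2 * (√p.lam * p.S) ^ 2 := by
        nlinarith [sq_nonneg (p.ρ * √(m * A) - √p.lam * p.S)]
    _ = 2 * (p.ρ ^ 2 * (m * A)) + 2 * (p.lam * p.S ^ 2) * 1 := by
        rw [mul_pow, mul_pow, Real.sq_sqrt (by positivity), Real.sq_sqrt h2.le, mul_one]
    _ ≤ 2 * (p.ρ ^ 2 * (m * ((1 + Real.log (2 / p.δ)) * (1 + Real.log s)))) +
        2 * (p.lam * p.S ^ 2) * (m * (1 + Real.log s)) := by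
        gcongr
        nlinarith
    _ = _ := by rw [Params.radiusConst]; ring

end Radius

/-! ### Feasibility and regret of one round of ROFUL -/

section Step

variable {d : ℕ} {P : Problem d} {p : Params} {xs : Vec d} {x : ℕ → Vec d} {y z : ℕ → ℝ} {t : ℕ}

lemma Problem.Admissible.norm_a_le_S (hP : P.Admissible p xs) : ‖P.a‖ ≤ p.S :=
  hP.norm_a_le.trans (le_max_left _ _)

lemma Problem.Admissible.norm_θ_le_S (hP : P.Admissible p xs) : ‖P.θ‖ ≤ p.S :=
  hP.norm_θ_le.trans (le_max_right _ _)

lemma Problem.Admissible.b_le_Sa (hp : p.Valid) (hP : P.Admissible p xs) : P.b ≤ p.Sa :=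
  (div_le_one hp.Sa_pos).1 hP.ν_le_one

lemma Problem.Admissible.b_le_S (hp : p.Valid) (hP : P.Admissible p xs) : P.b ≤ p.S :=
  (hP.b_le_Sa hp).trans (le_max_left _ _)

lemma Problem.Admissible.smul_mem (hP : P.Admissible p xs) {v : Vec d} (hv : v ∈ P.X) {c : ℝ}
    (h0 : 0 ≤ c) (h1 : c ≤ 1) : c • v ∈ P.X :=
  hP.star.smul_mem hv h0 h1

lemma Problem.Admissible.xs_ne_zero (hP : P.Admissible p xs) : xs ≠ 0 := by
  rintro rfl
  simpa using hP.reward_pos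

lemma inner_le_S_of_mem (hP : P.Admissible p xs) (hS : 0 ≤ p.S) {v : Vec d} (hv : v ∈ P.X) :
    inner ℝ P.θ v ≤ p.S := by
  refine (real_inner_le_norm _ _).trans ?_
  calc ‖P.θ‖ * ‖v‖ ≤ p.S * 1 :=
        mul_le_mul hP.norm_θ_le_S (hP.norm_le_one v hv) (norm_nonneg _) hS
    _ = p.S := mul_one _

lemma gap_le_regret (hP : P.Admissible p xs) {v : Vec d} (hv : v ∈ P.feasible)
    (hne : ∀ α : ℝ, 0 < α → v ≠ α • xs) : P.gap xs ≤ inner ℝ P.θ (xs - v) := by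
  refine csInf_le ⟨0, ?_⟩ ⟨v, hv, hne, rfl⟩
  rintro r ⟨w, hw, -, rfl⟩
  rw [inner_sub_right]
  linarith [hP.optimal.2 w hw]

/-- The action `0` is feasible and not a positive multiple of `xs`, so it competes in the infimum.
-/
lemma gap_le_S (hp : p.Valid) (hP : P.Admissible p xs) : P.gap xs ≤ p.S := by
  have h0 : (0 : Vec d) ∈ P.X := by
    simpa using hP.smul_mem hP.optimal.1.1 le_rfl zero_le_one
  refine (gap_le_regret hP (v := 0) ⟨h0, by simpa using hP.b_pos.le⟩ ?_).trans ?_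
  · intro α hα h
    exact (smul_ne_zero hα.ne' hP.xs_ne_zero) h.symm
  · rw [sub_zero]
    exact inner_le_S_of_mem hP hp.S_pos.le hP.optimal.1.1

lemma weightedNorm_smul (M : Matrix (Fin d) (Fin d) ℝ) {c : ℝ} (hc : 0 ≤ c) (v : Vec d) :
    weightedNorm M (c • v) = c * weightedNorm M v := by
  simp only [weightedNorm, WithLp.ofLp_smul, mulVec_smul, dotProduct_smul, smul_dotProduct,
    smul_eq_mul]
  rw [← mul_assoc, Real.sqrt_mul (mul_nonneg hc hc), Real.sqrt_mul_self hc]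

lemma width_smul {c : ℝ} (hc : 0 ≤ c) (v : Vec d) :
    width p x t (c • v) = c * width p x t v := by
  rw [width, weightedNorm_smul _ hc, width]; ring

lemma width_nonneg (hp : p.Valid) (v : Vec d) : 0 ≤ width p x t v :=
  mul_nonneg (radius_pos hp _ _).le (Real.sqrt_nonneg _)

lemma width_action (p : Params) (x : ℕ → Vec d) (t : ℕ) :
    width p x t (x t) = radius p d t * √(actionWidthSq p.lam x t) := rfl

lemma IsROFULStep.mem (hP : P.Admissible p xs) (h : IsROFULStep P p x y z t) :
    x t ∈ P.X := by
  obtain ⟨v, hv, -, m, hm, hxt⟩ := h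
  rw [hxt]
  refine hP.smul_mem hv.1 (le_max_of_le_right hm.1.1.1) (max_le (min_le_right _ _) hm.1.1.2)

lemma IsROFULStep.feasible (hp : p.Valid) (hP : P.Admissible p xs)
    (ha : ∀ v, |inner ℝ (estimator p.lam x z t - P.a) v| ≤ width p x t v)
    (h : IsROFULStep P p x y z t) : x t ∈ P.feasible := by
  refine ⟨h.mem hP, ?_⟩
  obtain ⟨v, hv, -, m, hm, hxt⟩ := h
  rw [hxt]
  -- Either the action has norm at most `b / Sa` and is safe for every admissible constraint vector,
  -- or it lies in the pessimistic set.
  rcases max_cases (min (P.b / p.Sa / ‖v‖) 1) m with ⟨h1, -⟩ | ⟨h1, -⟩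
  · rw [h1]
    have hν : 0 ≤ P.b / p.Sa := div_nonneg hP.b_pos.le hp.Sa_pos.le
    have h2 : ‖min (P.b / p.Sa / ‖v‖) 1 • v‖ ≤ P.b / p.Sa := by
      rw [norm_smul, Real.norm_of_nonneg (le_min (by positivity) zero_le_one)]
      calc min (P.b / p.Sa / ‖v‖) 1 * ‖v‖ ≤ P.b / p.Sa / ‖v‖ * ‖v‖ := by
            gcongr; exact min_le_left _ _
        _ ≤ P.b / p.Sa := by
            rcases eq_or_ne ‖v‖ 0 with h0 | h0
            · rw [h0, mul_zero]; exact hν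
            · rw [div_mul_cancel₀ _ h0]
    calc inner ℝ P.a (min (P.b / p.Sa / ‖v‖) 1 • v) ≤ ‖P.a‖ * _ := real_inner_le_norm _ _
      _ ≤ p.Sa * (P.b / p.Sa) := mul_le_mul hP.norm_a_le h2 (norm_nonneg _) hp.Sa_pos.le
      _ = P.b := mul_div_cancel₀ _ hp.Sa_pos.ne'
  · rw [h1]
    have h2 := hm.1.2.2
    have h3 := abs_le.1 (ha (m • v))
    rw [inner_sub_left] at h3
    linarith [h3.1]

/-- The regret of a round of ROFUL is at most `4 S / b` times the width of the action. -/
lemma IsROFULStep.regret_le (hp : p.Valid) (hP : P.Admissible p xs)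
    (hθ : ∀ v, |inner ℝ (estimator p.lam x y t - P.θ) v| ≤ width p x t v)
    (ha : ∀ v, |inner ℝ (estimator p.lam x z t - P.a) v| ≤ width p x t v)
    (h : IsROFULStep P p x y z t) :
    inner ℝ P.θ (xs - x t) ≤ 4 * p.S / P.b * width p x t (x t) := by
  obtain ⟨v, hv, hmax, m, hm, hxt⟩ := h
  have hb := hP.b_pos
  have hS := hp.S_pos
  have hw := width_nonneg (x := x) (t := t) hp v
  set γ := max (min (P.b / p.Sa / ‖v‖) 1) m with hγ
  have hγm : m ≤ γ := le_max_right _ _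
  have hm0 : 0 ≤ m := hm.1.1.1
  have hm1 : m ≤ 1 := hm.1.1.2
  have hγ0 : 0 ≤ γ := hm0.trans hγm
  have hγ1 : γ ≤ 1 := max_le (min_le_right _ _) hm1
  have hθv := abs_le.1 (hθ v)
  have hθxs := abs_le.1 (hθ xs)
  have hav := abs_le.1 (ha v)
  have haxs := abs_le.1 (ha xs)
  rw [inner_sub_left] at hθv hθxs hav haxs
  have hopt : xs ∈ optimistic P p x z t :=
    ⟨hP.optimal.1.1, by linarith [hP.optimal.1.2, haxs.2]⟩
  have hucb := hmax xs hopt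
  unfold ucb at hucb
  -- The loss from scaling. If `m < 1`, the pessimistic value `k` of `v` exceeds `b`; by homogeneity
  -- `b / k ≤ m ≤ γ`, and membership of `v` in the optimistic set gives `k ≤ b + 2 width v`.
  have hloss : (1 - γ) * P.b ≤ 2 * γ * width p x t v := by
    rcases hm1.eq_or_lt with h1 | h1
    · have : γ = 1 := le_antisymm hγ1 (h1 ▸ hγm)
      rw [this]; linarith
    · set k := inner ℝ (estimator p.lam x z t) v + width p x t v with hk
      have hkb : P.b < k := by
        by_contra hcon
        have : (1 : ℝ) ≤ m := hm.2 ⟨⟨zero_le_one, le_rfl⟩, by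
          rw [one_smul]; exact ⟨hv.1, not_lt.1 hcon⟩⟩
        linarith
      have hk0 : 0 < k := hb.trans hkb
      have hmk : P.b / k ≤ m := by
        refine hm.2 ⟨⟨by positivity, (div_le_one hk0).2 hkb.le⟩,
          hP.smul_mem hv.1 (by positivity) ((div_le_one hk0).2 hkb.le), ?_⟩
        rw [inner_smul_right, width_smul (by positivity), ← mul_add, ← hk,
          div_mul_cancel₀ _ hk0.ne']
      rw [div_le_iff₀ hk0] at hmk
      have hk2 : k ≤ P.b + 2 * width p x t v := by linarith [hv.2]
      nlinarith
  have hscale : P.b * width p x t v ≤ p.S * (γ * width p x t v) := by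
    rcases eq_or_ne v 0 with h0 | h0
    · have : width p x t v = 0 := by
        rw [h0]; simp [width, weightedNorm]
      rw [this]; simp
    · have h1 : P.b / p.Sa ≤ γ := by
        refine le_trans (le_min ?_ hP.ν_le_one) (le_max_left _ _)
        exact le_div_self (div_nonneg hb.le hp.Sa_pos.le) (norm_pos_iff.2 h0)
          (hP.norm_le_one v hv.1)
      rw [div_le_iff₀ hp.Sa_pos] at h1
      have h2 : P.b ≤ p.S * γ := h1.trans (by
        rw [mul_comm]; gcongr; exact le_max_left _ _)
      nlinarith
  have hθS : inner ℝ P.θ v ≤ p.S := inner_le_S_of_mem hP hS.le hv.1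
  rw [hxt, width_smul hγ0, inner_sub_right, inner_smul_right, div_mul_eq_mul_div,
    le_div_iff₀ hb]
  have h1 : (1 - γ) * P.b * inner ℝ P.θ v ≤ (1 - γ) * P.b * p.S := by
    have : 0 ≤ (1 - γ) * P.b := mul_nonneg (by linarith) hb.le
    gcongr
  -- Optimism: `xs` lies in the optimistic set, so its reward exceeds that of `v` by at most two
  -- widths. This and the scaling loss contribute `2 S γ width v` each to `b` times the regret,
  -- whence the factor `4`.
  have h2 : inner ℝ P.θ xs * P.b ≤ (inner ℝ P.θ v + 2 * width p x t v) * P.b := by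
    gcongr
    linarith [hθv.2, hθxs.1]
  nlinarith

end Step

/-! ### Play counts and the switching time -/

section Switch

variable {d : ℕ} {x : ℕ → Vec d} {B : ℝ} {t : ℕ}

lemma playCount_mono (x : ℕ → Vec d) (u : Vec d) {s t : ℕ} (h : s ≤ t) :
    playCount x u s ≤ playCount x u t := by
  classical
  exact Finset.card_le_card (Finset.filter_subset_filter _ (Finset.Ico_subset_Ico_right h))

lemma playCount_le (x : ℕ → Vec d) (u : Vec d) (t : ℕ) : playCount x u t ≤ t - 1 := by
  classical
  exact (Finset.card_filter_le _ _).trans (by simp)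

lemma Identified.mono {s : ℕ} (h : Identified B x s) (hst : s ≤ t) : Identified B x t := by
  obtain ⟨u, hu, hB⟩ := h
  exact ⟨u, hu, hB.trans_le (by exact_mod_cast playCount_mono x u hst)⟩

lemma Identified.exists_isSwitch (h : Identified B x t) : ∃ τ u, IsSwitch B x τ u ∧ τ ≤ t := by
  classical
  have hex : ∃ t, Identified B x t := ⟨t, h⟩
  set τ := Nat.find hex with hτ
  obtain ⟨u₀, hu₀, -⟩ := Nat.find_spec hex
  let s : Set ℕ := {n | ∃ u : Vec d, ‖u‖ = 1 ∧ playCount x u τ = n}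
  have hs : s.Nonempty := ⟨_, u₀, hu₀, rfl⟩
  have hbdd : BddAbove s := ⟨τ - 1, by rintro n ⟨u, -, rfl⟩; exact playCount_le x u τ⟩
  obtain ⟨u, hu, hun⟩ := Nat.sSup_mem hs hbdd
  refine ⟨τ, u, ⟨⟨Nat.find_spec hex, fun r hr => Nat.find_min' hex hr⟩, hu, fun v hv => ?_⟩,
    Nat.find_min' hex h⟩
  rw [hun]
  exact le_csSup hbdd ⟨v, hv, rfl⟩

/-- The rounds split into those before and those after the switch. -/
lemma exists_phase_split (B : ℝ) (x : ℕ → Vec d) (T : ℕ) :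
    ∃ n ≤ T, (∀ k ∈ Finset.Icc 1 n, ¬ Identified B x k) ∧
      ∀ k ∈ Finset.Ioc n T, Identified B x k := by
  induction T with
  | zero => exact ⟨0, le_rfl, by simp, by simp⟩
  | succ T ih =>
    by_cases hT : Identified B x (T + 1)
    · obtain ⟨n, hn, h1, h2⟩ := ih
      refine ⟨n, by omega, h1, fun k hk => ?_⟩
      rw [Finset.mem_Ioc] at hk
      rcases hk.2.eq_or_lt with h | h
      · rwa [h]
      · exact h2 k (by rw [Finset.mem_Ioc]; omega)
    · exact ⟨T + 1, le_rfl, fun k hk hI => hT (hI.mono (Finset.mem_Icc.1 hk).2), by simp⟩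

end Switch

/-! ### The first phase on a good path -/

section Path

variable {d : ℕ} {P : Problem d} {p : Params} {xs : Vec d} {x : ℕ → Vec d} {y z : ℕ → ℝ}
  {t T : ℕ} {B : ℝ}

lemma IsPDROFULPath.mem (hP : P.Admissible p xs)
    (h : IsPDROFULPath P p B T x y z) (ht : t ∈ Finset.Icc 1 T) : x t ∈ P.X := by
  obtain ⟨h1, h2⟩ := h t ht
  by_cases hI : Identified B x t
  · obtain ⟨τ, u, hsw, hτ⟩ := hI.exists_isSwitch
    obtain ⟨ξ, hξ, hx⟩ := h2 τ u hsw hτ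
    rw [hx]
    exact hξ.1.1
  · exact (h1 hI).mem hP

lemma IsPDROFULPath.norm_le_one (hP : P.Admissible p xs)
    (h : IsPDROFULPath P p B T x y z) (ht : t ∈ Finset.Icc 1 T) : ‖x t‖ ≤ 1 :=
  hP.norm_le_one _ (h.mem hP ht)

/-- The direction of `v`. -/
def direction (v : Vec d) : Vec d := ‖v‖⁻¹ • v

lemma norm_direction {v : Vec d} (hv : v ≠ 0) : ‖direction v‖ = 1 :=
  norm_smul_inv_norm (𝕜 := ℝ) hv

lemma direction_smul {c : ℝ} (hc : 0 < c) (v : Vec d) : ‖c • v‖⁻¹ • c • v = direction v := by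
  rw [direction, norm_smul, Real.norm_of_nonneg hc.le, smul_smul, mul_inv, mul_right_comm,
    inv_mul_cancel₀ hc.ne', one_mul]

open Classical in
/-- The component of `x_k` in direction `u` if this direction was played more than `B` times. -/
def directionScalar (B : ℝ) (u : Vec d) (x : ℕ → Vec d) (k : ℕ) : ℝ :=
  if B < playCount x u k then inner ℝ u (x k) else 0

/-- A realization of PD-ROFUL on which all confidence bounds hold. -/
structure GoodPath (P : Problem d) (p : Params) (xs : Vec d) (B : ℝ) (T : ℕ) (x : ℕ → Vec d)
    (ε η : ℕ → ℝ) : Prop where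
  path : IsPDROFULPath P p B T x (fun t => inner ℝ P.θ (x t) + ε t)
    (fun t => inner ℝ P.a (x t) + η t)
  conf_θ : ∀ t ∈ Finset.Icc 1 T, ∀ v,
    |inner ℝ (estimator p.lam x (fun t => inner ℝ P.θ (x t) + ε t) t - P.θ) v| ≤ width p x t v
  conf_a : ∀ t ∈ Finset.Icc 1 T, ∀ v,
    |inner ℝ (estimator p.lam x (fun t => inner ℝ P.a (x t) + η t) t - P.a) v| ≤ width p x t v
  conf_one : ∀ t ∈ Finset.Icc 1 T,
    (∑ k ∈ Finset.Ico 1 t, directionScalar B (direction xs) x k * η k) ^ 2 /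
      (p.lam + ∑ k ∈ Finset.Ico 1 t, directionScalar B (direction xs) x k ^ 2) ≤
    p.ρ ^ 2 * (Real.log ((p.lam + ∑ k ∈ Finset.Ico 1 t,
      directionScalar B (direction xs) x k ^ 2) / p.lam) + 2 * Real.log (1 / p.δ))

open Classical in
/-- The rounds up to `n` in which the direction of `xs` is not played. -/
def wrongRounds (xs : Vec d) (x : ℕ → Vec d) (n : ℕ) : Finset ℕ :=
  (Finset.Icc 1 n).filter fun k => ∀ α : ℝ, 0 < α → x k ≠ α • xs

lemma playCount_le_card_wrongRounds {u : Vec d} (hu : u ≠ direction xs) (n : ℕ) :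
    playCount x u (n + 1) ≤ (wrongRounds xs x n).card := by
  classical
  refine Finset.card_le_card fun k hk => ?_
  simp only [wrongRounds, Finset.mem_filter, Finset.mem_Ico, Finset.mem_Icc] at hk ⊢
  refine ⟨by omega, fun α hα h => hu ?_⟩
  rw [← hk.2, h, direction_smul hα]

/-- The summand `1` is round `n` itself, because `playCount` at `n` sees only earlier rounds. -/
lemma le_wrongRounds_add_playCount (n : ℕ) :
    n ≤ (wrongRounds xs x n).card + playCount x (direction xs) n + 1 := by
  classical
  have h : Finset.Icc 1 n ⊆ wrongRounds xs x n ∪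
      ((Finset.Ico 1 n).filter (fun k => ‖x k‖⁻¹ • x k = direction xs) ∪ {n}) := by
    intro k hk
    simp only [wrongRounds, Finset.mem_union, Finset.mem_filter, Finset.mem_Ico, Finset.mem_Icc,
      Finset.mem_singleton] at hk ⊢
    by_cases hw : ∀ α : ℝ, 0 < α → x k ≠ α • xs
    · exact Or.inl ⟨hk, hw⟩
    · push Not at hw
      obtain ⟨α, hα, hx⟩ := hw
      rcases hk.2.eq_or_lt with h | h
      · exact Or.inr (Or.inr h)
      · exact Or.inr (Or.inl ⟨⟨hk.1, h⟩, by rw [hx, direction_smul hα]⟩)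
  have h1 := (Finset.card_le_card h).trans ((Finset.card_union_le _ _).trans
    (Nat.add_le_add_left (Finset.card_union_le _ _) _))
  rw [Nat.card_Icc, Finset.card_singleton] at h1
  have : playCount x (direction xs) n =
    ((Finset.Ico 1 n).filter (fun k => ‖x k‖⁻¹ • x k = direction xs)).card := by
    unfold playCount; congr
  omega

variable {ε η : ℕ → ℝ} {n : ℕ}

/-- The bound on the regret of the first `n` rounds when they are rounds of ROFUL. -/
def roundsBound (d : ℕ) (b : ℝ) (p : Params) (n : ℕ) : ℝ :=
  4 * p.S / b * radius p d n * √(n * (3 / 2 * (d * Real.log (1 + n / (p.lam * d)))))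

lemma GoodPath.sum_actionWidthSq_le (hp : p.Valid) (hP : P.Admissible p xs) (hd : 0 < d)
    (h : GoodPath P p xs B T x ε η) (hn : n ≤ T) :
    ∑ k ∈ Finset.Icc 1 n, actionWidthSq p.lam x k ≤
      3 / 2 * (d * Real.log (1 + n / (p.lam * d))) := by
  have := SafeBandit.sum_actionWidthSq_le (x := x) hp.one_le_lam hd (t := n + 1) (by omega)
    (fun k hk => h.path.norm_le_one hP (by
      simp only [Finset.mem_Ico, Finset.mem_Icc] at hk ⊢; omega))
  rw [← Finset.Ico_add_one_right_eq_Icc]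
  simpa using this

lemma GoodPath.round_regret_le (hp : p.Valid) (hP : P.Admissible p xs)
    (h : GoodPath P p xs B T x ε η) (hn : n ≤ T)
    (hI : ∀ k ∈ Finset.Icc 1 n, ¬ Identified B x k) {k : ℕ} (hk : k ∈ Finset.Icc 1 n) :
    inner ℝ P.θ (xs - x k) ≤
      4 * p.S / P.b * radius p d n * √(actionWidthSq p.lam x k) := by
  have hk' := Finset.mem_Icc.1 hk
  have hkT : k ∈ Finset.Icc 1 T := by rw [Finset.mem_Icc]; omega
  have := ((h.path k hkT).1 (hI k hk)).regret_le hp hP (h.conf_θ k hkT) (h.conf_a k hkT)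
  rw [width_action, ← mul_assoc] at this
  refine this.trans ?_
  have hb := hP.b_pos
  have hS := hp.S_pos
  have := radius_mono hp d (s := k) (r := n) (by exact_mod_cast hk'.1) (by exact_mod_cast hk'.2)
  gcongr

lemma GoodPath.sum_regret_le_roundsBound (hp : p.Valid) (hP : P.Admissible p xs) (hd : 0 < d)
    (h : GoodPath P p xs B T x ε η) (hn : n ≤ T)
    (hI : ∀ k ∈ Finset.Icc 1 n, ¬ Identified B x k) :
    ∑ k ∈ Finset.Icc 1 n, inner ℝ P.θ (xs - x k) ≤ roundsBound d P.b p n := by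
  have hb := hP.b_pos
  have hS := hp.S_pos
  have hr := radius_pos hp d n
  refine (Finset.sum_le_sum fun k hk => h.round_regret_le hp hP hn hI hk).trans ?_
  rw [← Finset.mul_sum, roundsBound]
  gcongr
  refine Real.le_sqrt_of_sq_le ?_
  refine sq_sum_le_card_mul_sum_sq.trans ?_
  rw [Nat.card_Icc, Nat.add_sub_cancel]
  gcongr
  refine le_trans (le_of_eq ?_) (h.sum_actionWidthSq_le hp hP hd hn)
  exact Finset.sum_congr rfl fun k _ => Real.sq_sqrt (actionWidthSq_nonneg hp.lam_pos x k)

lemma threshold_nonneg (p : Params) (P : Problem d) (xs : Vec d) (T : ℕ) (hlam : 0 < p.lam) :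
    0 ≤ threshold P p xs T := by
  have : 0 ≤ Real.log (1 + T / (p.lam * d)) := Real.log_nonneg (by
    have : 0 ≤ (T : ℝ) / (p.lam * d) := by positivity
    linarith)
  unfold threshold; positivity

/-- Each such action is feasible, so its regret is at least the gap and at most `4 S β_T / b` times
its width. Summing squares against the potential bound gives the constant `16 * 3/2 = 24`, which is
`3/4` of the `32` in the threshold. -/
lemma GoodPath.card_wrongRounds_le (hp : p.Valid) (hP : P.Admissible p xs) (hd : 0 < d)
    (hgap : 0 < P.gap xs)
    (h : GoodPath P p xs B T x ε η) (hn : n ≤ T)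
    (hI : ∀ k ∈ Finset.Icc 1 n, ¬ Identified B x k) :
    ((wrongRounds xs x n).card : ℝ) ≤ 3 / 4 * threshold P p xs T := by
  classical
  have hb := hP.b_pos
  have hS := hp.S_pos
  rcases Nat.eq_zero_or_pos n with rfl | hn0
  · have := threshold_nonneg p P xs T hp.lam_pos
    simp [wrongRounds]; positivity
  have hr := radius_pos hp d T
  have hrn : radius p d n ≤ radius p d T :=
    radius_mono hp d (by exact_mod_cast hn0) (by exact_mod_cast hn)
  have hrn0 := radius_pos hp d n
  set K := 4 * p.S / P.b * radius p d T with hK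
  have h1 : ∀ k ∈ wrongRounds xs x n, P.gap xs ^ 2 ≤ K ^ 2 * actionWidthSq p.lam x k := by
    intro k hk
    rw [wrongRounds, Finset.mem_filter] at hk
    have hk' := Finset.mem_Icc.1 hk.1
    have hkT : k ∈ Finset.Icc 1 T := by rw [Finset.mem_Icc]; omega
    have hfeas := ((h.path k hkT).1 (hI k hk.1)).feasible hp hP (h.conf_a k hkT)
    have h2 := (gap_le_regret hP hfeas hk.2).trans (h.round_regret_le hp hP hn hI hk.1)
    calc P.gap xs ^ 2 ≤ (K * √(actionWidthSq p.lam x k)) ^ 2 := by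
          gcongr
          refine h2.trans ?_
          rw [hK]; gcongr
      _ = _ := by rw [mul_pow, Real.sq_sqrt (actionWidthSq_nonneg hp.lam_pos x k)]
  have h2 : ((wrongRounds xs x n).card : ℝ) * P.gap xs ^ 2 ≤
      K ^ 2 * (3 / 2 * (d * Real.log (1 + T / (p.lam * d)))) := by
    calc _ = ∑ k ∈ wrongRounds xs x n, P.gap xs ^ 2 := by simp
      _ ≤ ∑ k ∈ wrongRounds xs x n, K ^ 2 * actionWidthSq p.lam x k := Finset.sum_le_sum h1
      _ ≤ ∑ k ∈ Finset.Icc 1 T, K ^ 2 * actionWidthSq p.lam x k := by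
          refine Finset.sum_le_sum_of_subset_of_nonneg ?_ fun k _ _ =>
            mul_nonneg (sq_nonneg _) (actionWidthSq_nonneg hp.lam_pos x k)
          exact (Finset.filter_subset _ _).trans (Finset.Icc_subset_Icc_right hn)
      _ ≤ _ := by
          rw [← Finset.mul_sum]
          gcongr
          exact h.sum_actionWidthSq_le hp hP hd le_rfl
  rw [← le_div_iff₀ (by positivity)] at h2
  refine h2.trans (le_of_eq ?_)
  rw [threshold, hK]
  field_simp
  ring

/-- Wrong rounds contribute `3/4` of the threshold. The direction of `xs` contributes at most one
threshold, since it has not yet been identified, and the last round contributes one. -/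
lemma GoodPath.le_threshold (hp : p.Valid) (hP : P.Admissible p xs) (hd : 0 < d)
    (hgap : 0 < P.gap xs) (h : GoodPath P p xs (threshold P p xs T) T x ε η) (hn : n ≤ T)
    (hI : ∀ k ∈ Finset.Icc 1 n, ¬ Identified (threshold P p xs T) x k) :
    (n : ℝ) ≤ 7 / 4 * threshold P p xs T + 1 := by
  have hB := threshold_nonneg p P xs T hp.lam_pos
  rcases Nat.eq_zero_or_pos n with rfl | hn0
  · push_cast; linarith
  have h1 := h.card_wrongRounds_le hp hP hd hgap hn hI
  have h2 : (n : ℝ) ≤ (wrongRounds xs x n).card + playCount x (direction xs) n + 1 := by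
    exact_mod_cast le_wrongRounds_add_playCount n
  have h3 : (playCount x (direction xs) n : ℝ) ≤ threshold P p xs T := by
    by_contra hcon
    exact hI n (by rw [Finset.mem_Icc]; omega)
      ⟨_, norm_direction hP.xs_ne_zero, not_le.1 hcon⟩
  linarith

end Path

/-! ### The switch and the regret of one round after it -/

section SecondPhase

variable {d : ℕ} {P : Problem d} {p : Params} {xs : Vec d} {x : ℕ → Vec d}
  {t T n : ℕ} {ε η : ℕ → ℝ}

lemma IsSwitch.eq_of_split {B : ℝ} {τ : ℕ} {u : Vec d} (h : IsSwitch B x τ u)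
    (hpos : 1 ≤ τ) (hnT : n < T) (hI : ∀ k ∈ Finset.Icc 1 n, ¬ Identified B x k)
    (hJ : ∀ k ∈ Finset.Ioc n T, Identified B x k) : τ = n + 1 := by
  refine le_antisymm (h.1.2 (hJ (n + 1) (by rw [Finset.mem_Ioc]; omega))) ?_
  by_contra hcon
  exact hI τ (by rw [Finset.mem_Icc]; omega) h.1.1

lemma Identified.one_lt {B : ℝ} (hB : 0 ≤ B) (h : Identified B x t) : 1 < t := by
  obtain ⟨u, -, hu⟩ := h
  have h1 : 0 < playCount x u t := by exact_mod_cast hB.trans_lt hu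
  have := playCount_le x u t
  omega

/-- A most played direction other than that of `xs` would be played in wrong rounds only, hence at
most `3/4` of the threshold, whereas some direction exceeds the threshold. -/
lemma GoodPath.switch_eq (hp : p.Valid) (hP : P.Admissible p xs) (hd : 0 < d)
    (hgap : 0 < P.gap xs) (h : GoodPath P p xs (threshold P p xs T) T x ε η) (hnT : n < T)
    (hI : ∀ k ∈ Finset.Icc 1 n, ¬ Identified (threshold P p xs T) x k)
    (hJ : ∀ k ∈ Finset.Ioc n T, Identified (threshold P p xs T) x k) {τ : ℕ} {u : Vec d}
    (hsw : IsSwitch (threshold P p xs T) x τ u) : τ = n + 1 ∧ u = direction xs := by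
  have hB := threshold_nonneg p P xs T hp.lam_pos
  have hτ : τ = n + 1 := hsw.eq_of_split (hsw.1.1.one_lt hB).le hnT hI hJ
  refine ⟨hτ, ?_⟩
  by_contra hu
  obtain ⟨⟨⟨v, hv, hvB⟩, -⟩, -, hmax⟩ := hsw
  have h1 : (playCount x v τ : ℝ) ≤ playCount x u τ := by exact_mod_cast hmax v hv
  have h2 : (playCount x u τ : ℝ) ≤ (wrongRounds xs x n).card := by
    rw [hτ]; exact_mod_cast playCount_le_card_wrongRounds hu n
  have h3 := h.card_wrongRounds_le hp hP hd hgap hnT.le hI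
  linarith

lemma threshold_lt_of_identified (hnT : n < T)
    (hJ : ∀ k ∈ Finset.Ioc n T, Identified (threshold P p xs T) x k) :
    threshold P p xs T < T := by
  obtain ⟨u, -, hu⟩ := hJ (n + 1) (by rw [Finset.mem_Ioc]; omega)
  have h1 : (playCount x u (n + 1) : ℝ) ≤ n := by exact_mod_cast playCount_le x u (n + 1)
  have h2 : (n : ℝ) < T := by exact_mod_cast hnT
  linarith

/-- Once the direction of `xs` was played often enough, `directionScalar` is the component in that
direction. -/
lemma directionScalar_eq {B : ℝ} {u : Vec d} {k : ℕ} (h : B < playCount x u k) :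
    directionScalar B u x k = inner ℝ u (x k) := if_pos h

/-- This carries the tail bound for a predictable sequence over to the randomly started second
phase: before the switch no count exceeds `B`, so the summands vanish, and afterwards the count
stays above `B`. -/
lemma sum_directionScalar {B : ℝ} {u : Vec d} (hu : ‖u‖ = 1)
    (hI : ∀ k ∈ Finset.Icc 1 n, ¬ Identified B x k) (hB : B < playCount x u (n + 1))
    (f : ℝ → ℕ → ℝ) (hf : ∀ k, f 0 k = 0) :
    ∑ k ∈ Finset.Ico 1 t, f (directionScalar B u x k) k =
      ∑ k ∈ Finset.Ico (n + 1) t, f (inner ℝ u (x k)) k := by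
  symm
  rw [← Finset.sum_congr rfl (f := fun k => f (directionScalar B u x k) k)]
  · refine Finset.sum_subset (Finset.Ico_subset_Ico_left (by omega)) fun k hk hk' => ?_
    rw [Finset.mem_Ico] at hk hk'
    have : directionScalar B u x k = 0 :=
      if_neg fun hlt => hI k (by rw [Finset.mem_Icc]; omega) ⟨u, hu, hlt⟩
    rw [this, hf]
  · intro k hk
    rw [directionScalar_eq]
    exact hB.trans_le (by exact_mod_cast playCount_mono x u (Finset.mem_Ico.1 hk).1)

lemma lam_le_gram₁ (lam : ℝ) (x : ℕ → Vec d) (τ : ℕ) (u : Vec d) (t : ℕ) :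
    lam ≤ gram₁ lam x τ u t :=
  le_add_of_nonneg_right (Finset.sum_nonneg fun _ _ => sq_nonneg _)

/-- The error of the one-dimensional estimator. -/
lemma abs_estimator₁_sub_le {lam : ℝ} (hlam : 0 < lam) {τ : ℕ} {u a : Vec d} {r : ℝ}
    (hr : 0 ≤ r) (hu : ‖u‖ = 1) (hx : ∀ k ∈ Finset.Ico τ t, ∃ ξ : ℝ, x k = ξ • u)
    (h : (∑ k ∈ Finset.Ico τ t, inner ℝ u (x k) * η k) ^ 2 / gram₁ lam x τ u t ≤ r ^ 2) :
    |estimator₁ lam x (fun t => inner ℝ a (x t) + η t) τ u t - inner ℝ a u| ≤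
      (r + √lam * ‖a‖) / √(gram₁ lam x τ u t) := by
  set v := gram₁ lam x τ u t with hv
  have hvl : lam ≤ v := lam_le_gram₁ _ _ _ _ _
  have hv0 : 0 < v := hlam.trans_le hvl
  have hsv : 0 < √v := Real.sqrt_pos.2 hv0
  set N := ∑ k ∈ Finset.Ico τ t, inner ℝ u (x k) * η k with hN
  have hxa : ∀ k ∈ Finset.Ico τ t, inner ℝ a (x k) = inner ℝ u (x k) * inner ℝ a u := by
    intro k hk
    obtain ⟨ξ, hξ⟩ := hx k hk
    rw [hξ, inner_smul_right, inner_smul_right, real_inner_self_eq_norm_sq, hu]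
    ring
  have h1 : ∑ k ∈ Finset.Ico τ t, inner ℝ u (x k) * (inner ℝ a (x k) + η k) =
      (v - lam) * inner ℝ a u + N := by
    have : v - lam = ∑ k ∈ Finset.Ico τ t, inner ℝ u (x k) ^ 2 := by rw [hv, gram₁]; ring
    rw [this, Finset.sum_mul, hN, ← Finset.sum_add_distrib]
    refine Finset.sum_congr rfl fun k hk => ?_
    rw [hxa k hk]; ring
  have h2 : estimator₁ lam x (fun t => inner ℝ a (x t) + η t) τ u t - inner ℝ a u =
      (N - lam * inner ℝ a u) / v := by
    rw [estimator₁, h1, ← hv]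
    field_simp
    ring
  have h3 : |N| ≤ r * √v := by
    refine abs_le_of_sq_le_sq ?_ (by positivity)
    rw [mul_pow, Real.sq_sqrt hv0.le]
    exact (div_le_iff₀ hv0).1 h
  have h4 : |lam * inner ℝ a u| ≤ √lam * ‖a‖ * √v := by
    rw [abs_mul, abs_of_pos hlam]
    have h5 : |inner ℝ a u| ≤ ‖a‖ := by
      simpa [hu] using abs_real_inner_le_norm a u
    calc lam * |inner ℝ a u| = √lam * √lam * |inner ℝ a u| := by
          rw [Real.mul_self_sqrt hlam.le]
      _ ≤ √lam * √v * ‖a‖ := by gcongr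
      _ = _ := by ring
  rw [h2, abs_div, abs_of_pos hv0, div_le_div_iff₀ hv0 hsv]
  have h5 : |N - lam * inner ℝ a u| ≤ (r + √lam * ‖a‖) * √v :=
    (abs_sub _ _).trans (by linarith)
  calc |N - lam * inner ℝ a u| * √v ≤ (r + √lam * ‖a‖) * √v * √v := by gcongr
    _ = _ := by rw [mul_assoc, Real.mul_self_sqrt hv0.le]

/-- The regret of a scalar that is largest under a pessimistic constraint. -/
lemma regret_of_isGreatest_pessimistic₁ (hP : P.Admissible p xs) (hS : 0 < p.S) {z : ℕ → ℝ}
    {τ : ℕ} {ξ w : ℝ}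
    (hw : estimator₁ p.lam x z τ (direction xs) t - inner ℝ P.a (direction xs) +
      radius p 1 ((t : ℝ) - τ + 1) / √(gram₁ p.lam x τ (direction xs) t) ≤ w) (hw0 : 0 ≤ w)
    (hξ : IsGreatest (pessimistic₁ P p x z τ (direction xs) t) ξ) :
    inner ℝ P.θ (xs - ξ • direction xs) ≤ p.S / P.b * (w * |ξ|) := by
  have hb := hP.b_pos
  set u := direction xs with hu
  set c := radius p 1 ((t : ℝ) - τ + 1) / √(gram₁ p.lam x τ u t) with hc
  set φ := estimator₁ p.lam x z τ u t with hφ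
  set R := ‖xs‖ with hR
  have hR0 : 0 < R := norm_pos_iff.2 hP.xs_ne_zero
  have hxs : xs = R • u := by
    rw [hu, direction, smul_smul, mul_inv_cancel₀ hR0.ne', one_smul]
  have hmem : ∀ r : ℝ, 0 ≤ r → r ≤ R → r * (φ + c) ≤ P.b →
      r ∈ pessimistic₁ P p x z τ u t := by
    intro r h0 h1 h2
    refine ⟨?_, ?_⟩
    · have := hP.smul_mem hP.optimal.1.1 (c := r / R) (by positivity) ((div_le_one hR0).2 h1)
      rwa [hxs, smul_smul, div_mul_cancel₀ _ hR0.ne'] at this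
    · rw [abs_of_nonneg h0]
      calc _ = r * (φ + c) := by rw [hc]; ring
        _ ≤ P.b := h2
  have hξ0 : 0 ≤ ξ := hξ.2 (hmem 0 le_rfl hR0.le (by rw [zero_mul]; exact hb.le))
  have hθu : 0 ≤ inner ℝ P.θ u := by
    have := hP.reward_pos
    rw [hxs, inner_smul_right] at this
    exact (pos_of_mul_pos_right this hR0.le).le
  have hθxs : R * inner ℝ P.θ u ≤ p.S := by
    have := inner_le_S_of_mem hP hS.le hP.optimal.1.1
    rwa [hxs, inner_smul_right] at this
  have hreg : inner ℝ P.θ (xs - ξ • u) = (R - ξ) * inner ℝ P.θ u := by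
    rw [hxs, ← sub_smul, inner_smul_right]
  rw [hreg, abs_of_nonneg hξ0]
  rcases le_or_gt R ξ with hRξ | hRξ
  · have h1 : (R - ξ) * inner ℝ P.θ u ≤ 0 := mul_nonpos_of_nonpos_of_nonneg (by linarith) hθu
    exact h1.trans (by positivity)
  -- If `ξ < ‖xs‖`, then `‖xs‖` itself must violate the pessimistic constraint. Star-convexity then
  -- makes the constraint the only obstruction along the segment, so it binds at `ξ`.
  have hk : P.b < R * (φ + c) := by
    by_contra hcon
    exact hRξ.not_ge (hξ.2 (hmem R hR0.le le_rfl (not_lt.1 hcon)))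
  have hk0 : 0 < φ + c := pos_of_mul_pos_right (hb.trans hk) hR0.le
  have hbind : P.b ≤ ξ * (φ + c) := by
    rw [← div_le_iff₀ hk0]
    refine hξ.2 (hmem _ (by positivity) ?_ ?_)
    · rw [div_le_iff₀ hk0]; exact hk.le
    · rw [div_mul_cancel₀ _ hk0.ne']
  have hsafe : R * inner ℝ P.a u ≤ P.b := by
    have := hP.optimal.1.2
    rwa [hxs, inner_smul_right] at this
  -- Multiply the binding constraint by `R` and use the safety of `xs`, that is `R aᵀu ≤ b`. Only an
  -- upper bound on the estimate of `aᵀu` is needed, so the safety of the second-phase action plays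
  -- no role.
  have h1 : P.b * (R - ξ) ≤ R * (w * ξ) := by
    have h2 : P.b ≤ ξ * inner ℝ P.a u + ξ * w := hbind.trans (by nlinarith)
    nlinarith
  rw [div_mul_eq_mul_div, le_div_iff₀ hb]
  calc (R - ξ) * inner ℝ P.θ u * P.b = P.b * (R - ξ) * inner ℝ P.θ u := by ring
    _ ≤ R * (w * ξ) * inner ℝ P.θ u := by gcongr
    _ = R * inner ℝ P.θ u * (w * ξ) := by ring
    _ ≤ p.S * (w * ξ) := by gcongr

end SecondPhase

/-! ### Summing the regret of the second phase -/

section SecondPhaseSum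

variable {d : ℕ} {P : Problem d} {p : Params} {xs : Vec d} {x : ℕ → Vec d}
  {t T n : ℕ} {ε η : ℕ → ℝ}

lemma inner_sq_le_one {u v : Vec d} (hu : ‖u‖ = 1) (hv : ‖v‖ ≤ 1) : inner ℝ u v ^ 2 ≤ 1 := by
  have := abs_real_inner_le_norm u v
  rw [hu, one_mul] at this
  exact (sq_le_one_iff_abs_le_one _).2 (this.trans hv)

lemma gram₁_le {lam : ℝ} {τ : ℕ} {u : Vec d} (hu : ‖u‖ = 1) (hτ : τ ≤ t)
    (hx : ∀ k ∈ Finset.Ico τ t, ‖x k‖ ≤ 1) : gram₁ lam x τ u t ≤ lam + ((t : ℝ) - τ) := by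
  unfold gram₁
  gcongr
  calc _ ≤ ∑ k ∈ Finset.Ico τ t, (1 : ℝ) :=
        Finset.sum_le_sum fun k hk => inner_sq_le_one hu (hx k hk)
    _ = _ := by simp [Nat.cast_sub hτ]

lemma sum_sq_div_gram₁_le {lam : ℝ} (hlam : 1 ≤ lam) {τ : ℕ} {u : Vec d} (hu : ‖u‖ = 1)
    (hτ : τ ≤ t) (hx : ∀ k ∈ Finset.Ico τ t, ‖x k‖ ≤ 1) :
    ∑ k ∈ Finset.Ico τ t, inner ℝ u (x k) ^ 2 / gram₁ lam x τ u k ≤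
      3 / 2 * Real.log (gram₁ lam x τ u t / lam) := by
  have hlam0 : 0 < lam := by linarith
  induction t, hτ using Nat.le_induction with
  | base => simp [gram₁, div_self hlam0.ne']
  | succ t ht ih =>
    have hv : 0 < gram₁ lam x τ u t := hlam0.trans_le (lam_le_gram₁ _ _ _ _ _)
    have h1 : inner ℝ u (x t) ^ 2 ≤ 1 :=
      inner_sq_le_one hu (hx t (by rw [Finset.mem_Ico]; omega))
    have h2 : inner ℝ u (x t) ^ 2 / gram₁ lam x τ u t ≤ 1 := by
      rw [div_le_one hv]
      linarith [lam_le_gram₁ lam x τ u t]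
    have h3 : gram₁ lam x τ u (t + 1) / lam = gram₁ lam x τ u t / lam *
        (1 + inner ℝ u (x t) ^ 2 / gram₁ lam x τ u t) := by
      rw [gram₁, Finset.sum_Ico_succ_top ht, ← add_assoc, ← gram₁]
      field_simp
    have h4 : 0 ≤ inner ℝ u (x t) ^ 2 / gram₁ lam x τ u t := by positivity
    rw [Finset.sum_Ico_succ_top ht, h3, Real.log_mul (by positivity) (by positivity), mul_add]
    refine add_le_add (ih fun k hk => hx k ?_) (le_three_halves_log h4 h2)
    rw [Finset.mem_Ico] at hk ⊢; omega

/-- In dimension one the radius contains `log (2 / δ)` only once, while the tail bound costs `2 log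
(1 / δ)`. The estimation error is therefore bounded by `3/2` of the radius, since `(3/2)² ≥ 2`; the
pessimism of the algorithm adds one more radius, which makes `5/2`. -/
lemma GoodPath.second_round_regret_le (hp : p.Valid) (hP : P.Admissible p xs) (hd : 0 < d)
    (hgap : 0 < P.gap xs) (h : GoodPath P p xs (threshold P p xs T) T x ε η)
    (hI : ∀ k ∈ Finset.Icc 1 n, ¬ Identified (threshold P p xs T) x k)
    (hJ : ∀ k ∈ Finset.Ioc n T, Identified (threshold P p xs T) x k)
    (ht : t ∈ Finset.Ioc n T) :
    inner ℝ P.θ (xs - x t) ≤ 5 / 2 * p.S / P.b * radius p 1 T *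
      (|inner ℝ (direction xs) (x t)| / √(gram₁ p.lam x (n + 1) (direction xs) t)) := by
  have ht' := Finset.mem_Ioc.1 ht
  have hnT : n < T := by omega
  set u := direction xs with hu
  have hu1 : ‖u‖ = 1 := norm_direction hP.xs_ne_zero
  obtain ⟨τ, u', hsw, hτt⟩ := (hJ t ht).exists_isSwitch
  obtain ⟨rfl, rfl⟩ := h.switch_eq hp hP hd hgap hnT hI hJ hsw
  have hscalar : ∀ k, n < k → k ≤ T → ∃ ξ,
      IsGreatest (pessimistic₁ P p x (fun t => inner ℝ P.a (x t) + η t) (n + 1) u k) ξ ∧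
        x k = ξ • u := fun k h1 h2 =>
    (h.path k (by rw [Finset.mem_Icc]; omega)).2 (n + 1) u hsw h1
  have hB : threshold P p xs T < playCount x u (n + 1) := by
    obtain ⟨⟨⟨v, hv, hvB⟩, -⟩, -, hmax⟩ := hsw
    exact hvB.trans_le (by exact_mod_cast hmax v hv)
  obtain ⟨ξ, hξ, hxt⟩ := hscalar t ht'.1 ht'.2
  have hxξ : inner ℝ u (x t) = ξ := by
    rw [hxt, inner_smul_right, real_inner_self_eq_norm_sq, hu1]; ring
  have hconf := h.conf_one t (by rw [Finset.mem_Icc]; omega)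
  rw [← hu, sum_directionScalar hu1 hI hB (fun s k => s * η k) (by simp),
    sum_directionScalar hu1 hI hB (fun s _ => s ^ 2) (by simp), ← gram₁] at hconf
  set v := gram₁ p.lam x (n + 1) u t with hv
  have hlam := hp.lam_pos
  have hvl : p.lam ≤ v := lam_le_gram₁ _ _ _ _ _
  have hv0 : 0 < v := hlam.trans_le hvl
  set s : ℝ := (t : ℝ) - ((n + 1 : ℕ) : ℝ) + 1 with hs
  have hts : ((n + 1 : ℕ) : ℝ) ≤ t := by exact_mod_cast ht'.1
  have hs1 : 1 ≤ s := by rw [hs]; linarith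
  have hsT : s ≤ T := by
    have h1 : (t : ℝ) ≤ T := by exact_mod_cast ht'.2
    rw [hs]; push_cast; linarith [(Nat.cast_nonneg n : (0 : ℝ) ≤ n)]
  have hvs : v / p.lam ≤ 1 + (s - 1) / p.lam := by
    have := gram₁_le (lam := p.lam) hu1 (show n + 1 ≤ t by omega) (x := x) fun k hk =>
      h.path.norm_le_one hP (by simp only [Finset.mem_Ico, Finset.mem_Icc] at hk ⊢; omega)
    rw [div_le_iff₀ hlam, add_mul, div_mul_cancel₀ _ hlam.ne', one_mul, hs]
    linarith
  have hδ := hp.δ_pos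
  have hlogarg := log_radius_arg hp hs1
  have hlog2 := log_two_div_nonneg hp
  set A := Real.log ((1 + (s - 1) / p.lam) / (p.δ / 2)) with hA
  have hs2 : 0 ≤ (s - 1) / p.lam := div_nonneg (by linarith) hlam.le
  have hlogs : 0 ≤ Real.log (1 + (s - 1) / p.lam) := Real.log_nonneg (by linarith)
  have hA0 : 0 ≤ A := by rw [hlogarg]; positivity
  have hρ := hp.ρ_nonneg
  have herr := abs_estimator₁_sub_le (a := P.a) hlam
    (r := p.ρ * (3 / 2 * √(((1 : ℕ) : ℝ) * A))) (by positivity) hu1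
    (x := x) (t := t) (τ := n + 1) (η := η) (fun k hk => by
      rw [Finset.mem_Ico] at hk
      obtain ⟨ξ, -, hk⟩ := hscalar k (by omega) (by omega)
      exact ⟨ξ, hk⟩) (by
      refine hconf.trans ?_
      rw [mul_pow, mul_pow, Real.sq_sqrt (by positivity)]
      gcongr
      have h1 : Real.log (v / p.lam) ≤ Real.log (1 + (s - 1) / p.lam) := by gcongr
      have h2 : Real.log (1 / p.δ) ≤ Real.log (2 / p.δ) := by gcongr; norm_num
      rw [hlogarg]
      push_cast
      linarith)
  rw [← hv] at herr
  have hsv : 0 < √v := Real.sqrt_pos.2 hv0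
  have hS := hp.S_pos
  have hb := hP.b_pos
  have hradT := radius_mono hp 1 hs1 hsT
  have hrad0 := radius_pos hp 1 T
  have hrad : p.ρ * (3 / 2 * √(((1 : ℕ) : ℝ) * A)) + √p.lam * ‖P.a‖ ≤ 3 / 2 * radius p 1 T := by
    refine le_trans ?_ (mul_le_mul_of_nonneg_left hradT (by norm_num))
    have : √p.lam * ‖P.a‖ ≤ √p.lam * p.S := by gcongr; exact hP.norm_a_le_S
    have h0 : 0 ≤ √p.lam * p.S := by positivity
    rw [radius, ← hA]
    linarith
  have key := regret_of_isGreatest_pessimistic₁ hP hS (w := 5 / 2 * radius p 1 T / √v) (by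
    rw [← hs, ← hu, ← hv]
    calc _ ≤ 3 / 2 * radius p 1 T / √v + radius p 1 T / √v := by
          refine add_le_add ((le_abs_self _).trans (herr.trans ?_)) ?_ <;> gcongr
      _ = _ := by ring) (by positivity) hξ
  rw [hxξ, hxt]
  refine key.trans (le_of_eq ?_)
  ring

/-- The bound on the regret of the second phase. -/
def secondBound (b : ℝ) (p : Params) (T : ℕ) : ℝ :=
  5 / 2 * p.S / b * radius p 1 T * √(T * (3 / 2 * Real.log (1 + T / p.lam)))

lemma GoodPath.sum_regret_le_secondBound (hp : p.Valid) (hP : P.Admissible p xs) (hd : 0 < d)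
    (hgap : 0 < P.gap xs) (h : GoodPath P p xs (threshold P p xs T) T x ε η) (hnT : n ≤ T)
    (hI : ∀ k ∈ Finset.Icc 1 n, ¬ Identified (threshold P p xs T) x k)
    (hJ : ∀ k ∈ Finset.Ioc n T, Identified (threshold P p xs T) x k) :
    ∑ k ∈ Finset.Ioc n T, inner ℝ P.θ (xs - x k) ≤ secondBound P.b p T := by
  have hS := hp.S_pos
  have hb := hP.b_pos
  have hlam := hp.lam_pos
  have hrad0 := radius_pos hp 1 T
  have hu1 : ‖direction xs‖ = 1 := norm_direction hP.xs_ne_zero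
  refine (Finset.sum_le_sum fun k hk =>
    h.second_round_regret_le hp hP hd hgap hI hJ hk).trans ?_
  rw [← Finset.mul_sum, secondBound]
  gcongr
  refine Real.le_sqrt_of_sq_le ?_
  refine sq_sum_le_card_mul_sum_sq.trans ?_
  rw [Nat.card_Ioc]
  have hx : ∀ k ∈ Finset.Ico (n + 1) (T + 1), ‖x k‖ ≤ 1 := fun k hk =>
    h.path.norm_le_one hP (by simp only [Finset.mem_Ico, Finset.mem_Icc] at hk ⊢; omega)
  have h1 := sum_sq_div_gram₁_le hp.one_le_lam hu1 (show n + 1 ≤ T + 1 by omega) hx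
  have h2 := gram₁_le (lam := p.lam) hu1 (show n + 1 ≤ T + 1 by omega) hx
  have h3 : gram₁ p.lam x (n + 1) (direction xs) (T + 1) / p.lam ≤ 1 + T / p.lam := by
    rw [div_le_iff₀ hlam, add_mul, div_mul_cancel₀ _ hlam.ne', one_mul]
    refine h2.trans ?_
    push_cast
    linarith [(Nat.cast_nonneg n : (0 : ℝ) ≤ n)]
  have hv : 0 < gram₁ p.lam x (n + 1) (direction xs) (T + 1) :=
    hlam.trans_le (lam_le_gram₁ _ _ _ _ _)
  have h4 : ∑ k ∈ Finset.Ioc n T, (|inner ℝ (direction xs) (x k)| /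
      √(gram₁ p.lam x (n + 1) (direction xs) k)) ^ 2 ≤ 3 / 2 * Real.log (1 + T / p.lam) := by
    calc _ = ∑ k ∈ Finset.Ico (n + 1) (T + 1), inner ℝ (direction xs) (x k) ^ 2 /
          gram₁ p.lam x (n + 1) (direction xs) k := by
          have : Finset.Ioc n T = Finset.Ico (n + 1) (T + 1) := by ext k; simp
          rw [this]
          refine Finset.sum_congr rfl fun k _ => ?_
          rw [div_pow, sq_abs, Real.sq_sqrt (hlam.le.trans (lam_le_gram₁ _ _ _ _ _))]
      _ ≤ _ := h1
      _ ≤ _ := by gcongr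
  have h5 : ((T - n : ℕ) : ℝ) ≤ T := by exact_mod_cast Nat.sub_le T n
  exact mul_le_mul h5 h4 (Finset.sum_nonneg fun _ _ => sq_nonneg _) (Nat.cast_nonneg _)

/-- On a good path PD-ROFUL plays `n` rounds of ROFUL, and at most about twice the threshold. -/
lemma GoodPath.exists_regret_le (hp : p.Valid) (hP : P.Admissible p xs) (hd : 0 < d)
    (hgap : 0 < P.gap xs) (h : GoodPath P p xs (threshold P p xs T) T x ε η) :
    ∃ n ≤ T, (n : ℝ) ≤ 7 / 4 * threshold P p xs T + 1 ∧
      (regret P xs T x ≤ roundsBound d P.b p n ∨ threshold P p xs T < T ∧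
        regret P xs T x ≤ roundsBound d P.b p n + secondBound P.b p T) := by
  obtain ⟨n, hnT, hI, hJ⟩ := exists_phase_split (threshold P p xs T) x T
  refine ⟨n, hnT, h.le_threshold hp hP hd hgap hnT hI, ?_⟩
  have h1 := h.sum_regret_le_roundsBound hp hP hd hnT hI
  rcases hnT.eq_or_lt with rfl | hlt
  · exact Or.inl h1
  · refine Or.inr ⟨threshold_lt_of_identified hlt hJ, ?_⟩
    have h2 := h.sum_regret_le_secondBound hp hP hd hgap hnT hI hJ
    have h3 : regret P xs T x = ∑ k ∈ Finset.Icc 1 n, inner ℝ P.θ (xs - x k) +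
        ∑ k ∈ Finset.Ioc n T, inner ℝ P.θ (xs - x k) := by
      rw [regret, ← Finset.sum_union]
      · congr 1
        ext k
        simp only [Finset.mem_union, Finset.mem_Icc, Finset.mem_Ioc]
        omega
      · rw [Finset.disjoint_left]
        intro k hk hk'
        simp only [Finset.mem_Icc, Finset.mem_Ioc] at hk hk'
        omega
    linarith

end SecondPhaseSum

/-! ### Numerical comparison with the explicit regret bound -/

section Bounds

variable {d : ℕ} {P : Problem d} {p : Params} {xs : Vec d} {T n : ℕ}

lemma log_nonneg_of_ratio {q r : ℝ} (hq : 0 ≤ q) (hr : 0 ≤ r) : 0 ≤ Real.log (1 + q / r) :=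
  Real.log_nonneg (by linarith [div_nonneg hq hr])

lemma lam_mul_dim_pos (hp : p.Valid) (hd : 2 ≤ d) : 2 ≤ p.lam * d := by
  have : (2 : ℝ) ≤ d := by exact_mod_cast hd
  nlinarith [hp.one_le_lam]

/-- A lower bound free of the problem data: `β_T² ≥ lam S²`, while `b` and the gap are both at most
`S`. -/
lemma mul_log_le_threshold (hp : p.Valid) (hP : P.Admissible p xs)
    (hgap : 0 < P.gap xs) (T : ℕ) :
    32 * (p.lam * d) * Real.log (1 + T / (p.lam * d)) ≤ threshold P p xs T := by
  have hb := hP.b_pos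
  have hS := hp.S_pos
  have hlam := hp.lam_pos
  have hL : 0 ≤ Real.log (1 + T / (p.lam * d)) := log_nonneg_of_ratio (by positivity) (by positivity)
  have h1 : p.lam * p.S ^ 2 ≤ radius p d T ^ 2 := by
    have := pow_le_pow_left₀ (by positivity) (sqrt_lam_mul_S_le_radius hp d T) 2
    rwa [mul_pow, Real.sq_sqrt hlam.le] at this
  rw [threshold]
  gcongr
  rw [le_div_iff₀ (by positivity)]
  have h2 : P.b ^ 2 ≤ p.S ^ 2 := pow_le_pow_left₀ hb.le (hP.b_le_S hp) 2
  have h3 : P.gap xs ^ 2 ≤ p.S ^ 2 := pow_le_pow_left₀ hgap.le (gap_le_S hp hP) 2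
  calc 32 * (p.lam * d) * (P.b ^ 2 * P.gap xs ^ 2) ≤ 32 * (p.lam * d) * (p.S ^ 2 * p.S ^ 2) := by
        gcongr
    _ = 32 * p.S ^ 2 * (p.lam * p.S ^ 2) * d := by ring
    _ ≤ _ := by gcongr

lemma div_le_log_one_add {y : ℝ} (hy : 0 ≤ y) : y / (1 + y) ≤ Real.log (1 + y) := by
  have h := Real.one_sub_inv_le_log_of_pos (show 0 < 1 + y by linarith)
  refine le_trans (le_of_eq ?_) h
  have : (1 + y) ≠ 0 := by positivity
  field_simp
  ring

/-- From `log (1 + T / q) ≥ 1 / (q + 1)` with `q = lam d ≥ 2` one gets `32 q / (q + 1) ≥ 64 / 3`.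
This lets the threshold absorb the additive `1` in the length of the first phase. -/
lemma twenty_le_threshold (hp : p.Valid) (hP : P.Admissible p xs) (hd : 2 ≤ d)
    (hgap : 0 < P.gap xs) (hT : 1 ≤ T) : 20 ≤ threshold P p xs T := by
  refine le_trans ?_ (mul_log_le_threshold hp hP hgap T)
  have hq := lam_mul_dim_pos hp hd
  set q := p.lam * d
  have hT' : (1 : ℝ) ≤ T := by exact_mod_cast hT
  have h1 : 1 / (q + 1) ≤ Real.log (1 + T / q) := by
    calc 1 / (q + 1) = 1 / q / (1 + 1 / q) := by field_simp
      _ ≤ Real.log (1 + 1 / q) := div_le_log_one_add (by positivity)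
      _ ≤ _ := by gcongr
  calc (20 : ℝ) ≤ 32 * q * (1 / (q + 1)) := by
        rw [mul_one_div, le_div_iff₀ (by linarith)]; linarith
    _ ≤ _ := by gcongr

/-- The square root in the first part of the regret bound, with its factor. -/
def firstBound (P : Problem d) (p : Params) (xs : Vec d) (T : ℕ) : ℝ :=
  4 * p.S / P.b * (radius p d (2 * threshold P p xs T) *
    √(d * threshold P p xs T * Real.log (1 + 2 * threshold P p xs T / (p.lam * d))))

lemma firstBound_nonneg (hp : p.Valid) (hP : P.Admissible p xs) : 0 ≤ firstBound P p xs T := by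
  have hb := hP.b_pos
  have hS := hp.S_pos
  have := radius_pos hp d (2 * threshold P p xs T)
  unfold firstBound; positivity

lemma regretBound_eq : regretBound P p xs T = 2 * firstBound P p xs T +
    4 * p.S / P.b * radius p 1 T * √(2 * T * Real.log (1 + T / (p.lam * d))) := by
  rw [regretBound, firstBound]; ring

/-- For `B ≥ 20` the inequality `n ≤ 7/4 B + 1` gives both `n ≤ 2 B`, which handles the radius and
the logarithm, and `3/2 n ≤ (17/10)² B`, which handles the square root. -/
lemma roundsBound_le (hp : p.Valid) (hP : P.Admissible p xs) (hd : 2 ≤ d)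
    (hgap : 0 < P.gap xs) (hT : 1 ≤ T) (hn : (n : ℝ) ≤ 7 / 4 * threshold P p xs T + 1) :
    roundsBound d P.b p n ≤ 17 / 10 * firstBound P p xs T := by
  have hb := hP.b_pos
  have hS := hp.S_pos
  have hlam := hp.lam_pos
  rcases Nat.eq_zero_or_pos n with rfl | hn0
  · have := firstBound_nonneg (T := T) hp hP
    rw [roundsBound]
    simp only [Nat.cast_zero, zero_mul, Real.sqrt_zero, mul_zero]
    positivity
  have hB := twenty_le_threshold hp hP hd hgap hT
  set B := threshold P p xs T with hBdef
  have hr : radius p d n ≤ radius p d (2 * B) :=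
    radius_mono hp d (by exact_mod_cast hn0) (by linarith)
  have hr0 := radius_pos hp d n
  have hL : 0 ≤ Real.log (1 + n / (p.lam * d)) := log_nonneg_of_ratio (by positivity) (by positivity)
  have hL2 : Real.log (1 + n / (p.lam * d)) ≤ Real.log (1 + 2 * B / (p.lam * d)) := by
    have h2n : (n : ℝ) / (p.lam * d) ≤ 2 * B / (p.lam * d) :=
      div_le_div_of_nonneg_right (by linarith) (by positivity)
    exact Real.log_le_log (by positivity) (by linarith)
  have hr2 := hr0.trans_le hr
  have h1 : √(n * (3 / 2 * (d * Real.log (1 + n / (p.lam * d))))) ≤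
      17 / 10 * √(d * B * Real.log (1 + 2 * B / (p.lam * d))) := by
    rw [show (17 / 10 : ℝ) = √((17 / 10) ^ 2) by rw [Real.sqrt_sq (by norm_num)],
      ← Real.sqrt_mul (by positivity)]
    refine Real.sqrt_le_sqrt ?_
    calc (n : ℝ) * (3 / 2 * (d * Real.log (1 + n / (p.lam * d))))
        = (3 / 2 * n) * (d * Real.log (1 + n / (p.lam * d))) := by ring
      _ ≤ ((17 / 10) ^ 2 * B) * (d * Real.log (1 + 2 * B / (p.lam * d))) := by
          refine mul_le_mul (by linarith) ?_ (by positivity) (by positivity)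
          gcongr
      _ = _ := by ring
  rw [roundsBound, firstBound, ← hBdef]
  calc _ ≤ 4 * p.S / P.b * radius p d (2 * B) *
        (17 / 10 * √(d * B * Real.log (1 + 2 * B / (p.lam * d)))) := by gcongr
    _ = _ := by ring

/-- Since `s ≤ r`, one has `1 + s r ≤ (1 + r)²`, and concavity of the logarithm gives `s log (1 + r)
≤ r log (1 + s)`. -/
lemma mul_log_one_add_mul_le {s r : ℝ} (hs : 0 ≤ s) (hr : 0 < r) (hsr : s ≤ r) :
    s * Real.log (1 + s * r) ≤ 2 * r * Real.log (1 + s) := by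
  have hc := strictConcaveOn_log_Ioi.concaveOn.2 (Set.mem_Ioi.2 (one_pos (α := ℝ)))
    (Set.mem_Ioi.2 (show 0 < 1 + r by linarith))
    (sub_nonneg.2 ((div_le_one hr).2 hsr)) (by positivity : 0 ≤ s / r) (by ring)
  simp only [smul_eq_mul, Real.log_one, mul_zero, zero_add, mul_one] at hc
  rw [show 1 - s / r + s / r * (1 + r) = 1 + s by field_simp; ring, div_mul_eq_mul_div,
    div_le_iff₀ hr] at hc
  have h1 : Real.log (1 + s * r) ≤ 2 * Real.log (1 + r) := by
    have h2 : (2 : ℝ) * Real.log (1 + r) = Real.log ((1 + r) ^ 2) := by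
      rw [Real.log_pow]; norm_num
    rw [h2]
    refine Real.log_le_log (by positivity) ?_
    nlinarith
  nlinarith

/-- A second phase forces a long horizon: with `s = T / (lam d)` the hypothesis gives `32 log (1 +
s) < s`, and `log (1 + s) ≥ s / (1 + s)` yields `s > 31`. Then `log (1 + s) ≥ 5 log 2 ≥ 3`. -/
lemma ratio_of_threshold_lt (hp : p.Valid) (hP : P.Admissible p xs) (hd : 2 ≤ d)
    (hgap : 0 < P.gap xs) (hT : 1 ≤ T) (h : threshold P p xs T < T) :
    31 < T / (p.lam * d) ∧ 3 ≤ Real.log (1 + T / (p.lam * d)) := by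
  have hq := lam_mul_dim_pos hp hd
  have h1 := (mul_log_le_threshold hp hP hgap T).trans_lt h
  set q := p.lam * d
  have hT' : (1 : ℝ) ≤ T := by exact_mod_cast hT
  set s := (T : ℝ) / q with hs
  have hTs : (T : ℝ) = q * s := by rw [hs]; field_simp
  have hs0 : 0 < s := by positivity
  rw [hTs] at h1
  have h2 : 32 * Real.log (1 + s) < s := by nlinarith
  have h3 := div_le_log_one_add hs0.le
  have h4 : 31 < s := by
    have h5 : 32 * (s / (1 + s)) < s := by linarith
    rw [← mul_div_assoc, div_lt_iff₀ (by linarith)] at h5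
    nlinarith
  refine ⟨h4, ?_⟩
  have h5 : Real.log ((2 : ℝ) ^ 5) ≤ Real.log (1 + s) :=
    Real.log_le_log (by norm_num) (by norm_num; linarith)
  rw [Real.log_pow] at h5
  push_cast at h5
  linarith [Real.log_two_gt_d9]

/-- The logarithm at `s` is at most `log (1 + d²) ≤ 2 log (1 + d)`, and the dimension factor `d ≥ 2`
of the larger radius pays for the `2`. -/
lemma radius_one_le_radius (hp : p.Valid) (hd : 2 ≤ d) {s r : ℝ} (hs : 1 ≤ s)
    (hsd : (s - 1) / p.lam ≤ d * d) (hr : 1 + d * p.lam ≤ r) : radius p 1 s ≤ radius p d r := by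
  have hlam := hp.lam_pos
  have hρ := hp.ρ_nonneg
  have hd' : (2 : ℝ) ≤ d := by exact_mod_cast hd
  have hr1 : 1 ≤ r := by nlinarith
  have h2 := log_two_div_nonneg hp
  have h3 : 0 ≤ (s - 1) / p.lam := div_nonneg (by linarith) hlam.le
  have h4 : (d : ℝ) ≤ (r - 1) / p.lam := by rw [le_div_iff₀ hlam]; linarith
  have h5 : Real.log (1 + (s - 1) / p.lam) ≤ 2 * Real.log (1 + (r - 1) / p.lam) := by
    have h6 : (2 : ℝ) * Real.log (1 + (r - 1) / p.lam) =
        Real.log ((1 + (r - 1) / p.lam) ^ 2) := by rw [Real.log_pow]; norm_num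
    rw [h6]
    refine Real.log_le_log (by positivity) ?_
    nlinarith
  have h6 : 0 ≤ Real.log (1 + (r - 1) / p.lam) := Real.log_nonneg (by linarith)
  rw [radius, radius, log_radius_arg hp hs, log_radius_arg hp hr1]
  have h7 : ((1 : ℕ) : ℝ) * (Real.log (1 + (s - 1) / p.lam) + Real.log (2 / p.δ)) ≤
      d * (Real.log (1 + (r - 1) / p.lam) + Real.log (2 / p.δ)) := by
    push_cast
    nlinarith
  gcongr

lemma secondBound_le (hp : p.Valid) (hP : P.Admissible p xs) (hd : 2 ≤ d)
    (hgap : 0 < P.gap xs) (hT : 1 ≤ T) (h : threshold P p xs T < T) :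
    secondBound P.b p T ≤ 3 / 10 * firstBound P p xs T +
      4 * p.S / P.b * radius p 1 T * √(2 * T * Real.log (1 + T / (p.lam * d))) := by
  have hb := hP.b_pos
  have hS := hp.S_pos
  have hlam := hp.lam_pos
  have hd' : (2 : ℝ) ≤ d := by exact_mod_cast hd
  have hT' : (1 : ℝ) ≤ T := by exact_mod_cast hT
  have hq := lam_mul_dim_pos hp hd
  have hr0 := radius_pos hp 1 T
  obtain ⟨hs31, hL⟩ := ratio_of_threshold_lt hp hP hd hgap hT h
  have hB := mul_log_le_threshold hp hP hgap T
  have hfirst := firstBound_nonneg (T := T) hp hP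
  set s : ℝ := T / (p.lam * d) with hs
  have hTs : (T : ℝ) = p.lam * d * s := by rw [hs]; field_simp
  have hTlam : (T : ℝ) / p.lam = s * d := by rw [hTs]; field_simp
  have hlogT : 0 ≤ Real.log (1 + T / p.lam) := log_nonneg_of_ratio (by positivity) hlam.le
  -- The cases are `T ≤ lam d²` and `T > lam d²`. In the first the horizon is so short that the
  -- whole second phase fits into the slack of the first-phase term; in the second `log (1 + T /
  -- lam)` is at most twice the logarithm in the claim.
  rcases le_or_gt s d with hsd | hsd
  · have hlast : 0 ≤ 4 * p.S / P.b * radius p 1 T * √(2 * T * Real.log (1 + s)) := by positivity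
    refine le_trans ?_ (le_add_of_nonneg_right hlast)
    rw [firstBound]
    set B := threshold P p xs T with hBdef
    have hrad : radius p 1 T ≤ radius p d (2 * B) := by
      refine radius_one_le_radius hp hd hT' ?_ ?_
      · calc ((T : ℝ) - 1) / p.lam ≤ T / p.lam := by gcongr; linarith
          _ = s * d := hTlam
          _ ≤ d * d := by gcongr
      · nlinarith
    have hr2 := hr0.trans_le hrad
    have hB0 : 0 ≤ B := threshold_nonneg p P xs T hlam
    have hratio : 2 ≤ 2 * B / (p.lam * d) := by
      rw [le_div_iff₀ (by linarith)]
      nlinarith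
    have hl2 : 1 ≤ Real.log (1 + 2 * B / (p.lam * d)) := by
      rw [Real.le_log_iff_exp_le (by linarith)]
      linarith [Real.exp_one_lt_d9]
    -- The factor `12/25` is what the slack allows: `5/2 * 12/25 = 4 * 3/10`. The logarithm inside
    -- `firstBound` is at least 1 and is simply dropped.
    have hsqrt : √(T * (3 / 2 * Real.log (1 + T / p.lam))) ≤
        12 / 25 * √(d * B * Real.log (1 + 2 * B / (p.lam * d))) := by
      rw [show (12 / 25 : ℝ) = √((12 / 25) ^ 2) by rw [Real.sqrt_sq (by norm_num)],
        ← Real.sqrt_mul (by positivity)]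
      refine Real.sqrt_le_sqrt ?_
      have h1 := mul_log_one_add_mul_le (by linarith : 0 ≤ s) (by linarith : (0 : ℝ) < d) hsd
      have h2 : 0 ≤ d * (p.lam * d) * Real.log (1 + s) := by positivity
      calc (T : ℝ) * (3 / 2 * Real.log (1 + T / p.lam))
          = 3 / 2 * (p.lam * d) * (s * Real.log (1 + s * d)) := by rw [hTlam, hTs]; ring
        _ ≤ 3 / 2 * (p.lam * d) * (2 * d * Real.log (1 + s)) := by gcongr
        _ ≤ (12 / 25) ^ 2 * (d * (32 * (p.lam * d) * Real.log (1 + s)) * 1) := by nlinarith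
        _ ≤ _ := by gcongr
    rw [secondBound]
    calc _ ≤ 5 / 2 * p.S / P.b * radius p d (2 * B) *
          (12 / 25 * √(d * B * Real.log (1 + 2 * B / (p.lam * d)))) := by gcongr
      _ = _ := by ring
  · refine le_trans ?_ (le_add_of_nonneg_left (by positivity))
    have h1 : Real.log (1 + T / p.lam) ≤ 2 * Real.log (1 + s) := by
      have h2 : (2 : ℝ) * Real.log (1 + s) = Real.log ((1 + s) ^ 2) := by
        rw [Real.log_pow]; norm_num
      rw [h2, hTlam]
      refine Real.log_le_log (by positivity) ?_
      nlinarith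
    -- Here `8/5` is chosen because `5/2 * 8/5 = 4`.
    have hsqrt : √(T * (3 / 2 * Real.log (1 + T / p.lam))) ≤
        8 / 5 * √(2 * T * Real.log (1 + s)) := by
      rw [show (8 / 5 : ℝ) = √((8 / 5) ^ 2) by rw [Real.sqrt_sq (by norm_num)],
        ← Real.sqrt_mul (by positivity)]
      refine Real.sqrt_le_sqrt ?_
      have h2 : 0 ≤ T * Real.log (1 + s) := by positivity
      calc (T : ℝ) * (3 / 2 * Real.log (1 + T / p.lam)) ≤
            T * (3 / 2 * (2 * Real.log (1 + s))) := by gcongr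
        _ ≤ _ := by nlinarith
    rw [secondBound]
    calc _ ≤ 5 / 2 * p.S / P.b * radius p 1 T * (8 / 5 * √(2 * T * Real.log (1 + s))) := by
          gcongr
      _ = _ := by ring

lemma GoodPath.regret_le_regretBound {x : ℕ → Vec d} {ε η : ℕ → ℝ} (hp : p.Valid)
    (hP : P.Admissible p xs) (hd : 2 ≤ d) (hgap : 0 < P.gap xs)
    (h : GoodPath P p xs (threshold P p xs T) T x ε η) (hT : 1 ≤ T) :
    regret P xs T x ≤ regretBound P p xs T := by
  have hb := hP.b_pos
  have hS := hp.S_pos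
  have hr0 := radius_pos hp 1 T
  have hfirst := firstBound_nonneg (T := T) hp hP
  have hY : 0 ≤ 4 * p.S / P.b * radius p 1 T * √(2 * T * Real.log (1 + T / (p.lam * d))) := by
    positivity
  obtain ⟨n, -, hn, h1 | ⟨hlt, h1⟩⟩ := h.exists_regret_le hp hP (by omega) hgap
  · have := roundsBound_le hp hP hd hgap hT hn
    rw [regretBound_eq]
    linarith
  · have h2 := roundsBound_le hp hP hd hgap hT hn
    have h3 := secondBound_le hp hP hd hgap hT hlt
    rw [regretBound_eq]
    linarith

/-! ### The bound up to logarithms -/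

lemma log_one_add_le {T : ℝ} (hT : 1 ≤ T) : Real.log (1 + T) ≤ 1 + Real.log T := by
  have h1 : Real.log (1 + T) ≤ Real.log (2 * T) := Real.log_le_log (by linarith) (by linarith)
  rw [Real.log_mul (by norm_num) (by linarith)] at h1
  linarith [Real.log_two_lt_d9]

/-- The explicit bound is no help here, since its `β_{2B̄}` and logarithm involve `log (1 / (b Δ))`,
which no power of `1 + log T` controls. Instead the radius and logarithm are estimated through `n ≤
T`, and the threshold enters only through the factor `√n`. -/
lemma roundsBound_le_polylog (hp : p.Valid) (hP : P.Admissible p xs) (hd : 2 ≤ d)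
    (hgap : 0 < P.gap xs) (hT : 1 ≤ T) (hnT : n ≤ T)
    (hn : (n : ℝ) ≤ 7 / 4 * threshold P p xs T + 1) :
    roundsBound d P.b p n ≤ 40 * p.S ^ 2 * p.radiusConst * (1 + Real.log T) ^ 2 *
      ((d : ℝ) ^ 2 / (P.b ^ 2 * P.gap xs)) := by
  have hb := hP.b_pos
  have hS := hp.S_pos
  have hlam := hp.lam_pos
  have hC := radiusConst_nonneg hp
  have hT' : (1 : ℝ) ≤ T := by exact_mod_cast hT
  have hlogT : 0 ≤ Real.log T := Real.log_nonneg hT'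
  rcases Nat.eq_zero_or_pos n with rfl | hn0
  · rw [roundsBound]
    simp only [Nat.cast_zero, zero_mul, Real.sqrt_zero, mul_zero]
    positivity
  have hB := twenty_le_threshold hp hP hd hgap hT
  have hq := lam_mul_dim_pos hp hd
  have hr : radius p d n ≤ radius p d T :=
    radius_mono hp d (by exact_mod_cast hn0) (by exact_mod_cast hnT)
  have hr0 := radius_pos hp d n
  have hrT := radius_pos hp d T
  set ℓ := 1 + Real.log T with hℓ
  have hℓ1 : 1 ≤ ℓ := by linarith
  have hlog : Real.log (1 + T / (p.lam * d)) ≤ ℓ := by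
    refine le_trans ?_ (log_one_add_le hT')
    have : (T : ℝ) / (p.lam * d) ≤ T := div_le_self (by linarith) (by linarith)
    gcongr
  have hlogn : Real.log (1 + n / (p.lam * d)) ≤ ℓ := by
    refine le_trans ?_ hlog
    gcongr
  have hlogn0 : 0 ≤ Real.log (1 + n / (p.lam * d)) :=
    log_nonneg_of_ratio (by positivity) (by positivity)
  have hthr : threshold P p xs T ≤
      32 * p.S ^ 2 * radius p d T ^ 2 * d / (P.b ^ 2 * P.gap xs ^ 2) * ℓ := by
    rw [threshold]; gcongr
  have hsqrt : √(n * (3 / 2 * (d * Real.log (1 + n / (p.lam * d))))) ≤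
      -- From `n ≤ 2 B` the constant under the root is `2 * 32 * 3/2 = 96 ≤ 10²`.
      10 * (p.S * radius p d T * d * ℓ / (P.b * P.gap xs)) := by
    refine Real.sqrt_le_iff.2 ⟨by positivity, ?_⟩
    calc (n : ℝ) * (3 / 2 * (d * Real.log (1 + n / (p.lam * d))))
        ≤ (2 * (32 * p.S ^ 2 * radius p d T ^ 2 * d / (P.b ^ 2 * P.gap xs ^ 2) * ℓ)) *
          (3 / 2 * (d * ℓ)) := by
          gcongr
          linarith
      _ = 96 * (p.S * radius p d T * d * ℓ / (P.b * P.gap xs)) ^ 2 := by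
          field_simp
          ring
      _ ≤ _ := by
          rw [mul_pow]
          gcongr
          norm_num
  have hrsq := radius_sq_le hp (m := d) (by omega) hT'
  rw [← hℓ] at hrsq
  calc roundsBound d P.b p n ≤ 4 * p.S / P.b * radius p d T *
        (10 * (p.S * radius p d T * d * ℓ / (P.b * P.gap xs))) := by
        rw [roundsBound]; gcongr
    _ = 40 * p.S ^ 2 * radius p d T ^ 2 * (d * ℓ / (P.b ^ 2 * P.gap xs)) := by
        field_simp
        ring
    _ ≤ 40 * p.S ^ 2 * (d * p.radiusConst * ℓ) * (d * ℓ / (P.b ^ 2 * P.gap xs)) := by gcongr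
    _ = _ := by ring

lemma secondBound_le_polylog (hp : p.Valid) {b : ℝ} (hb : 0 < b) (hT : 1 ≤ T) :
    secondBound b p T ≤ 4 * p.S * √p.radiusConst * (1 + Real.log T) ^ 2 * (√T / b) := by
  have hS := hp.S_pos
  have hlam := hp.lam_pos
  have hC := radiusConst_nonneg hp
  have hT' : (1 : ℝ) ≤ T := by exact_mod_cast hT
  have hlogT : 0 ≤ Real.log T := Real.log_nonneg hT'
  have hrsq := radius_sq_le hp (m := 1) le_rfl hT'
  have hrT := radius_pos hp 1 T
  set ℓ := 1 + Real.log T with hℓ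
  have hℓ1 : 1 ≤ ℓ := by linarith
  have hr : radius p 1 T ≤ √p.radiusConst * √ℓ := by
    rw [← Real.sqrt_mul hC]
    refine Real.le_sqrt_of_sq_le (hrsq.trans (le_of_eq ?_))
    push_cast; ring
  have hlog : Real.log (1 + T / p.lam) ≤ ℓ := by
    refine le_trans ?_ (log_one_add_le hT')
    have : (T : ℝ) / p.lam ≤ T := div_le_self (by linarith) hp.one_le_lam
    gcongr
  have hsqrt : √(T * (3 / 2 * Real.log (1 + T / p.lam))) ≤ 8 / 5 * (√T * √ℓ) := by
    rw [← Real.sqrt_mul (by positivity), show (8 / 5 : ℝ) = √((8 / 5) ^ 2) by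
      rw [Real.sqrt_sq (by norm_num)], ← Real.sqrt_mul (by positivity)]
    refine Real.sqrt_le_sqrt ?_
    calc (T : ℝ) * (3 / 2 * Real.log (1 + T / p.lam)) ≤ T * (3 / 2 * ℓ) := by gcongr
      _ ≤ T * ((8 / 5) ^ 2 * ℓ) := by
          gcongr
          norm_num
      _ = _ := by ring
  calc secondBound b p T ≤ 5 / 2 * p.S / b * (√p.radiusConst * √ℓ) * (8 / 5 * (√T * √ℓ)) := by
        rw [secondBound]; gcongr
    _ = 4 * p.S * √p.radiusConst * (√ℓ * √ℓ) * (√T / b) := by ring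
    _ = 4 * p.S * √p.radiusConst * ℓ * (√T / b) := by
        rw [Real.mul_self_sqrt (by linarith)]
    _ ≤ _ := by
        gcongr
        nlinarith

/-- The constant in the asymptotic regret bound. -/
def Params.regretConst (p : Params) : ℝ :=
  40 * p.S ^ 2 * p.radiusConst + 4 * p.S * √p.radiusConst

lemma regretConst_nonneg (hp : p.Valid) : 0 ≤ p.regretConst := by
  have hS := hp.S_pos
  have hC := radiusConst_nonneg hp
  unfold Params.regretConst; positivity

lemma GoodPath.regret_le_polylog {x : ℕ → Vec d} {ε η : ℕ → ℝ} (hp : p.Valid)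
    (hP : P.Admissible p xs) (hd : 2 ≤ d) (hgap : 0 < P.gap xs)
    (h : GoodPath P p xs (threshold P p xs T) T x ε η) (hT : 1 ≤ T) :
    regret P xs T x ≤ p.regretConst * (1 + Real.log T) ^ 2 *
      ((d : ℝ) ^ 2 / (P.b ^ 2 * P.gap xs) + √T / P.b) := by
  have hb := hP.b_pos
  have hS := hp.S_pos
  have hC := radiusConst_nonneg hp
  have hmono : ∀ q₁ q₂ : ℝ, 0 ≤ q₁ → 0 ≤ q₂ → 40 * p.S ^ 2 * p.radiusConst *
      (1 + Real.log T) ^ 2 * q₁ + 4 * p.S * √p.radiusConst * (1 + Real.log T) ^ 2 * q₂ ≤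
      p.regretConst * (1 + Real.log T) ^ 2 * (q₁ + q₂) := by
    intro q₁ q₂ h1 h2
    have h3 : 0 ≤ 40 * p.S ^ 2 * p.radiusConst * (1 + Real.log T) ^ 2 * q₂ := by positivity
    have h4 : 0 ≤ 4 * p.S * √p.radiusConst * (1 + Real.log T) ^ 2 * q₁ := by positivity
    rw [Params.regretConst]
    linarith
  have h2 := secondBound_le_polylog hp hb hT
  have h2' : 0 ≤ 4 * p.S * √p.radiusConst * (1 + Real.log T) ^ 2 * (√T / P.b) := by positivity
  refine le_trans ?_ (hmono _ _ (by positivity) (by positivity))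
  obtain ⟨n, hnT, hn, h1 | ⟨-, h1⟩⟩ := h.exists_regret_le hp hP (by omega) hgap
  all_goals
    have := roundsBound_le_polylog hp hP hd hgap hT hnT hn
    linarith

lemma regret_zero (x : ℕ → Vec d) : regret P xs 0 x = 0 := by simp [regret]

end Bounds

/-! ### The probability of a good path -/

section Probability

variable {d : ℕ} {Ω : Type*} {x : ℕ → Ω → Vec d} {ε η : ℕ → Ω → ℝ}

-- Predictability: the value in round `k` depends only on the actions up to round `k`, because the
-- direction is a fixed vector rather than the one identified by the algorithm.
open Classical in
lemma measurable_directionScalar (B : ℝ) (u : Vec d) {k : ℕ} (hk : 1 ≤ k) :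
    Measurable[history x ε k] fun ω => directionScalar B u (fun t => x t ω) k := by
  have hx : ∀ j ∈ Finset.Icc 1 k, Measurable[history x ε k] (x j) :=
    fun j hj => measurable_action hj
  have hcount : Measurable[history x ε k] fun ω => (playCount (fun t => x t ω) u k : ℝ) := by
    have : (fun ω => (playCount (fun t => x t ω) u k : ℝ)) = fun ω =>
        ∑ j ∈ Finset.Ico 1 k, if ‖x j ω‖⁻¹ • x j ω = u then (1 : ℝ) else 0 := by
      ext ω
      rw [playCount, Finset.card_filter]
      push_cast
      rfl
    rw [this]
    refine Finset.measurable_fun_sum _ fun j hj => ?_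
    have hj' : Measurable[history x ε k] (x j) :=
      hx j (by simp only [Finset.mem_Ico, Finset.mem_Icc] at hj ⊢; omega)
    refine Measurable.ite ?_ measurable_const measurable_const
    have hdir : Measurable fun v : Vec d => ‖v‖⁻¹ • v := by fun_prop
    exact hdir.comp hj' (measurableSet_singleton u)
  refine Measurable.ite (hcount (measurableSet_Ioi (a := B))) ?_ measurable_const
  exact measurable_const.inner (hx k (by rw [Finset.mem_Icc]; omega))

variable [mΩ : MeasurableSpace Ω] {μ : Measure Ω} [IsProbabilityMeasure μ] {P : Problem d}
  {p : Params} {xs : Vec d} {T : ℕ}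

/-- The confidence bounds hold with probability at least `1 - 2 δ`. -/
theorem measure_not_goodPath_le (hp : p.Valid) (hd : 2 ≤ d) (hP : P.Admissible p xs)
    (h : IsPDROFULRun μ P p xs T x ε η) :
    μ {ω | ¬ GoodPath P p xs (threshold P p xs T) T (fun t => x t ω) (fun t => ε t ω)
      (fun t => η t ω)} ≤ ENNReal.ofReal (2 * p.δ) := by
  have hδ := hp.δ_pos
  have hx := h.measurable
  have hX : ∀ {e : ℕ → Ω → ℝ}, ∀ k ∈ Finset.Icc 1 T, Measurable[history x e k] (x k) :=
    fun k hk => measurable_action (by simp only [Finset.mem_Icc] at hk ⊢; omega)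
  have h1 := measure_selfNormalized_le hx hp.ρ_nonneg h.reward_noise hX hp.one_le_lam
    (half_pos hδ)
  have h2 := measure_selfNormalized_le hx hp.ρ_nonneg h.constraint_noise hX hp.one_le_lam
    (half_pos hδ)
  have h3 := measure_selfNormalized_one_le hx hp.ρ_nonneg h.constraint_noise
    (g := fun k ω => directionScalar (threshold P p xs T) (direction xs) (fun t => x t ω) k)
    (fun k hk => measurable_directionScalar _ _ (Finset.mem_Icc.1 hk).1) hp.one_le_lam hδ
  -- The budget is `δ/2` for each of the two `d`-dimensional estimators and `δ` for the
  -- one-dimensional one.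
  refine le_trans (measure_mono ?_) ((measure_union_le _ _).trans (add_le_add
    ((measure_union_le _ _).trans (add_le_add h1 h2)) h3) |>.trans (le_of_eq ?_))
  · intro ω hω
    by_contra hcon
    simp only [Set.mem_union, Set.mem_ofPred_eq, not_or, not_not] at hcon
    obtain ⟨⟨g1, g2⟩, g3⟩ := hcon
    have hmem : ∀ t ∈ Finset.Icc 1 T, t ∈ Finset.Icc 1 (T + 1) := fun t ht => by
      simp only [Finset.mem_Icc] at ht ⊢; omega
    have hnorm : ∀ t ∈ Finset.Icc 1 T, ∀ k ∈ Finset.Ico 1 t, ‖x k ω‖ ≤ 1 := by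
      intro t ht k hk
      have hk' : k ∈ Finset.Icc 1 T := by
        simp only [Finset.mem_Ico, Finset.mem_Icc] at ht hk ⊢; omega
      exact hP.norm_le_one _ ((h.path ω).mem hP hk')
    have c1 := fun t ht => abs_inner_estimator_sub_le_width (x := fun t => x t ω)
      (e := fun t => ε t ω) hp hd hP.norm_θ_le_S (Finset.mem_Icc.1 ht).1 (hnorm t ht)
      (g1 t (hmem t ht))
    have c2 := fun t ht => abs_inner_estimator_sub_le_width (x := fun t => x t ω)
      (e := fun t => η t ω) hp hd hP.norm_a_le_S (Finset.mem_Icc.1 ht).1 (hnorm t ht)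
      (g2 t (hmem t ht))
    exact hω ⟨h.path ω, c1, c2, fun t ht => g3 t (hmem t ht)⟩
  · rw [← ENNReal.ofReal_add (by positivity) (by positivity),
      ← ENNReal.ofReal_add (by positivity) (by positivity)]
    congr 1
    ring

/-- A property that holds on all good paths has probability at least `1 - 2 δ`. -/
theorem le_measureReal_of_goodPath (hp : p.Valid) (hd : 2 ≤ d) (hP : P.Admissible p xs)
    (h : IsPDROFULRun μ P p xs T x ε η) {G : Set Ω}
    (hG : ∀ ω, GoodPath P p xs (threshold P p xs T) T (fun t => x t ω) (fun t => ε t ω)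
      (fun t => η t ω) → ω ∈ G) : 1 - 2 * p.δ ≤ μ.real G := by
  have h1 : μ.real Gᶜ ≤ 2 * p.δ := by
    refine ENNReal.toReal_le_of_le_ofReal (by linarith [hp.δ_pos]) ?_
    refine le_trans (measure_mono fun ω hω => ?_) (measure_not_goodPath_le hp hd hP h)
    exact fun hgood => hω (hG ω hgood)
  -- Subadditivity suffices, so `G` need not be measurable.
  have h2 : μ.real (Set.univ : Set Ω) ≤ μ.real G + μ.real Gᶜ := by
    rw [← Set.union_compl_self G]
    exact measureReal_union_le _ _
  rw [probReal_univ] at h2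
  linarith

end Probability

end SafeBandit

end

theorem corollary1 (p : Params) (hp : p.Valid) :
    (∀ (d : ℕ) (_ : 2 ≤ d) (P : Problem d) (xs : Vec d) (T : ℕ)
      (Ω : Type*) (_ : MeasurableSpace Ω) (μ : Measure Ω) (_ : IsProbabilityMeasure μ)
      (x : ℕ → Ω → Vec d) (ε η : ℕ → Ω → ℝ),
      P.Admissible p xs → 0 < P.gap xs → IsPDROFULRun μ P p xs T x ε η →
        1 - 2 * p.δ ≤ μ.real {ω | regret P xs T (fun t => x t ω) ≤ regretBound P p xs T}) ∧
    ∃ (C : ℝ) (n : ℕ), ∀ (d : ℕ) (_ : 2 ≤ d) (P : Problem d) (xs : Vec d) (T : ℕ)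
      (Ω : Type*) (_ : MeasurableSpace Ω) (μ : Measure Ω) (_ : IsProbabilityMeasure μ)
      (x : ℕ → Ω → Vec d) (ε η : ℕ → Ω → ℝ),
      P.Admissible p xs → 0 < P.gap xs → IsPDROFULRun μ P p xs T x ε η →
        1 - 2 * p.δ ≤ μ.real {ω | regret P xs T (fun t => x t ω) ≤
          C * (1 + Real.log T) ^ n * ((d : ℝ) ^ 2 / (P.b ^ 2 * P.gap xs) + √T / P.b)} := by
  refine ⟨?_, p.regretConst, 2, ?_⟩
  · intro d hd P xs T Ω _ μ _ x ε η hP hgap hrun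
    refine le_measureReal_of_goodPath hp hd hP hrun fun ω hω => ?_
    -- The comparison of constants needs `T ≥ 1`, as the threshold is `0` at `T = 0`; an empty
    -- horizon has no regret and the bound is nonnegative.
    rcases Nat.eq_zero_or_pos T with rfl | hT
    · have h1 := firstBound_nonneg (T := 0) hp hP
      have h2 := radius_pos hp 1 ((0 : ℕ) : ℝ)
      have hb := hP.b_pos
      have hS := hp.S_pos
      simp only [Set.mem_ofPred_eq, regret_zero, regretBound_eq]
      positivity
    · exact hω.regret_le_regretBound hp hP hd hgap hT
  · intro d hd P xs T Ω _ μ _ x ε η hP hgap hrun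
    refine le_measureReal_of_goodPath hp hd hP hrun fun ω hω => ?_
    rcases Nat.eq_zero_or_pos T with rfl | hT
    · have h1 := regretConst_nonneg hp
      have hb := hP.b_pos
      simp only [Set.mem_ofPred_eq, regret_zero, Nat.cast_zero, Real.log_zero]
      positivity
    · exact hω.regret_le_polylog hp hP hd hgap hT
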